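/- Consider one time slot of a random hello protocol with $M\ge 1$ orthogonal resource blocks (RBs). A typical node sits at the origin of $\mathbb{R}^2$; the other nodes, at locations $X_i$, form a homogeneous Poisson point process of density $\lambda>0$. Each node (including the typical one) independently transmits with probability $\rho\in(0,1)$ and receives otherwise; a transmitting node uses one RB chosen uniformly at random among the $M$. All links have Rayleigh fading, i.e. the fading power gains $h_i$ (of node $i$ as a target) and $g_i$ (of node $i$ as an interferer) are exponential with mean $1$; transmission modes, RBs and gains are independent of each other, across nodes, and of the locations (the joint law of the two gains $h_i,g_i$ of one and the same node is irrelevant). The path loss exponent is $\alpha=4$, and $\sigma^2\ge 0$ is the noise power divided by the common transmit power. For a transmitting node $i$, let $$\Xi_i=\frac{|X_i|^{-4}h_i}{\sum_{j}|X_j|^{-4}g_j+\sigma^2},$$ where $j$ runs over all transmitting nodes $j\ne i$ that use the same RB as node $i$. For a threshold $\xi>0$, let $S$ be the number of transmitting nodes $i$ with $\Xi_i>\xi$ if the typical node is receiving, and $S=0$ if it is transmitting. Then, if $\sigma^2>0$, $$\frac{2}{\pi}\,\frac{M(1-\rho)}{\sqrt{\xi}}\,\frac{\kappa\rho^2}{1+\kappa\rho^2}<\mathbb{E}\{S\}<\frac{2}{\pi}\,\frac{M(1-\rho)}{\sqrt{\xi}},\qquad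 \kappa=\frac{\lambda^2\pi^4}{8M^2\sigma^2},$$ and, if $\sigma^2=0$, $$\mathbb{E}\{S\}=\frac{2}{\pi}\,\frac{M(1-\rho)}{\sqrt{\xi}},$$ so that the upper bound is the zero-noise value. The same bounds and the same zero-noise identity hold for every real $M>0$ when $\mathbb{E}\{S\}$ is read as $M$ times the average number of nodes discovered on a single RB on which the nodes form a homogeneous Poisson point process of density $\lambda/M$. -/

import Mathlib

open MeasureTheory ProbabilityTheory
open scoped ENNReal NNReal

noncomputable section

/-- The random sequence of points `X 0, X 1, …` is an enumeration (with multiplicity) of a Poisson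
point process with intensity measure `Λ`: the number of points in a set `B` of finite intensity
has the Poisson law with mean `Λ B`, and the numbers of points in pairwise disjoint sets are
independent. -/
structure IsPoissonProcess {Ω E : Type*} [MeasurableSpace Ω] [MeasurableSpace E]
    (P : Measure Ω) (Λ : Measure E) (X : ℕ → Ω → E) : Prop where
  measurable : ∀ i, Measurable (X i)
  count_law : ∀ B : Set E, MeasurableSet B → Λ B ≠ ∞ → ∀ k : ℕ,
    P {ω | {i : ℕ | X i ω ∈ B}.encard = (k : ℕ∞)} = poissonMeasure (Λ B).toNNReal {k}
  count_indep : ∀ (n : ℕ) (B : Fin n → Set E), (∀ j, MeasurableSet (B j)) →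
    Pairwise (fun j k => Disjoint (B j) (B k)) →
    iIndepFun (fun (j : Fin n) (ω : Ω) => {i : ℕ | X i ω ∈ B j}.encard) P

/-- The Euclidean plane. -/
abbrev Plane : Type := EuclideanSpace ℝ (Fin 2)

/-- The law of the power gain of a Rayleigh fading link: exponential with mean one. -/
def rayleighGain : Measure ℝ := expMeasure 1

/-- One time slot of the multichannel random hello protocol, seen by a typical node at the origin.
The other nodes are indexed by `ℕ` and form a homogeneous Poisson point process of density `lam` in
the plane. There are `M` resource blocks. Every node, the typical one included, transmits with
probability `ρ` and receives otherwise; a transmitting node uses a uniformly chosen resource block.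
All fading power gains have the law `ν`. Modes, resource blocks and gains are independent of one
another, from node to node, and of the locations. (The two gains `h i` and `g i` of one and the
same node never occur in the same SINR, and their joint law is left free.) -/
structure HelloSlot {Ω : Type*} [MeasurableSpace Ω] (P : Measure Ω)
    (lam : ℝ) (M : ℕ) (ρ : ℝ) (ν : Measure ℝ) where
  /-- the location of node `i` -/
  X : ℕ → Ω → Plane
  /-- the typical node transmits -/
  tx₀ : Ω → Bool
  /-- node `i` transmits -/
  tx : ℕ → Ω → Bool
  /-- the resource block of node `i` -/
  rb : ℕ → Ω → Fin M
  /-- the gain from node `i` to the typical node when node `i` is the target -/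
  h : ℕ → Ω → ℝ
  /-- the gain from node `i` to the typical node when node `i` is an interferer -/
  g : ℕ → Ω → ℝ
  measurable_tx₀ : Measurable tx₀
  measurable_tx : ∀ i, Measurable (tx i)
  measurable_rb : ∀ i, Measurable (rb i)
  measurable_h : ∀ i, Measurable (h i)
  measurable_g : ∀ i, Measurable (g i)
  poisson : IsPoissonProcess P (ENNReal.ofReal lam • (volume : Measure Plane)) X
  law_tx₀ : P {ω | tx₀ ω = true} = ENNReal.ofReal ρ
  law_tx : ∀ i, P {ω | tx i ω = true} = ENNReal.ofReal ρ
  law_rb : ∀ i m, P {ω | rb i ω = m} = (M : ℝ≥0∞)⁻¹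
  law_h : ∀ i, P.map (h i) = ν
  law_g : ∀ i, P.map (g i) = ν
  indep_tx_rb : ∀ i, IndepFun (tx i) (rb i) P
  indep_mode_gain : ∀ i, IndepFun (fun ω => (tx i ω, rb i ω)) (fun ω => (h i ω, g i ω)) P
  indep_nodes : iIndepFun (fun i ω => ((tx i ω, rb i ω), (h i ω, g i ω))) P
  indep_typical : IndepFun tx₀ (fun ω i => ((tx i ω, rb i ω), (h i ω, g i ω))) P
  indep_location : IndepFun (fun ω i => X i ω)
    (fun ω => (tx₀ ω, fun i : ℕ => ((tx i ω, rb i ω), (h i ω, g i ω)))) P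

namespace HelloSlot

variable {Ω : Type*} [MeasurableSpace Ω] {P : Measure Ω} {lam : ℝ} {M : ℕ} {ρ : ℝ} {ν : Measure ℝ}

open Classical in
/-- The interference that the packet of node `i` undergoes, with path loss exponent `α`: the power
received from all the other nodes that transmit on the resource block of node `i`. -/
def interference (s : HelloSlot P lam M ρ ν) (α : ℝ) (i : ℕ) (ω : Ω) : ℝ≥0∞ :=
  ∑' j : ℕ, if j ≠ i ∧ s.tx j ω = true ∧ s.rb j ω = s.rb i ω
    then ENNReal.ofReal (‖s.X j ω‖ ^ (-α) * s.g j ω) else 0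

/-- The SINR of the packet of node `i` at the typical node, where `noise` is the noise power
divided by the common transmit power. -/
def sinr (s : HelloSlot P lam M ρ ν) (α noise : ℝ) (i : ℕ) (ω : Ω) : ℝ≥0∞ :=
  ENNReal.ofReal (‖s.X i ω‖ ^ (-α) * s.h i ω) / (s.interference α i ω + ENNReal.ofReal noise)

/-- The number `S` of nodes, over all resource blocks, that the typical node discovers: it must be
receiving, and the discovered node must transmit and be received with an SINR above `ξ`. -/
def discovered (s : HelloSlot P lam M ρ ν) (α noise ξ : ℝ) (ω : Ω) : ℕ∞ :=
  {i : ℕ | s.tx₀ ω = false ∧ s.tx i ω = true ∧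
    ENNReal.ofReal ξ < s.sinr α noise i ω}.encard

/-- The average number `E{S}` of discovered nodes. -/
def meanDiscovered (s : HelloSlot P lam M ρ ν) (α noise ξ : ℝ) : ℝ≥0∞ :=
  ∫⁻ ω, (s.discovered α noise ξ ω : ℝ≥0∞) ∂P

end HelloSlot

/-- The constant `κ = λ² π⁴ / (8 M² σ²)`. -/
def kappa (lam M noise : ℝ) : ℝ := lam ^ 2 * Real.pi ^ 4 / (8 * M ^ 2 * noise)

/-- The upper bound, `(2/π) · M (1 - ρ) / √ξ`. -/
def upperBound (M ρ ξ : ℝ) : ℝ := 2 / Real.pi * (M * (1 - ρ) / Real.sqrt ξ)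

/-- The lower bound, `(2/π) · M (1 - ρ) / √ξ · κ ρ² / (1 + κ ρ²)`. -/
def lowerBound (lam M ρ ξ noise : ℝ) : ℝ :=
  2 / Real.pi * (M * (1 - ρ) / Real.sqrt ξ) *
    (kappa lam M noise * ρ ^ 2 / (1 + kappa lam M noise * ρ ^ 2))

end

/-! Condition on the locations. The target gain is exponential, so the probability of beating the
threshold is the exponential of minus the rescaled interference plus noise, which factors over the
interferers. With `p = ρ / M` and relative strength `θ`, a single interferer contributes the factor
`1 - p * (θ / (1 + θ))`: it is silent on the block with probability `1 - p`, and otherwise the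
Laplace transform of its gain gives `1 / (1 + θ)`.

In squared distances, `r` for the target and `t` for the interferer, path loss exponent four gives
`θ / (1 + θ) = ξ r² / (t² + ξ r²)`, and the squared distances form a Poisson process of constant
rate `μ = λ π` on the half-line. Since `ξ r² / (t² + ξ r²)` has integral `√ξ r π / 2` over `t > 0`,
the Palm formula gives `E{S} = (1 - ρ) ρ μ ∫ exp (-(b r² + a r)) dr` with `b = ξ σ²` and `a = μ p √ξ
π / 2` (`meanDiscovered_four_eq`). This integral is `1 / a` for `b = 0`; for `b > 0` it lies
strictly between `a / (a² + 2 b)` and `1 / a`, and `a² / (2 b) = κ ρ²`.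

The process is specified only through its counts, so the Palm formula is obtained by discretisation.
For functionals that see points only through annuli of equal area, it reduces to independent Poisson
counts (`IsPoissonProcess.lintegral_cells`). The true functional is monotone in both distances;
rounding them to multiples of `δ` in opposite directions brackets it, and the error vanishes as `δ →
0` (`lintegral_palmSum`). -/

/-- The function `t ↦ exp (-t)` on `[0, ∞]`. -/
noncomputable def expNeg (t : ℝ≥0∞) : ℝ≥0∞ := EReal.exp (-(t : EReal))

@[simp] lemma expNeg_zero : expNeg 0 = 1 := by simp [expNeg]

@[simp] lemma expNeg_top : expNeg ∞ = 0 := by simp [expNeg]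

lemma expNeg_ofReal {x : ℝ} (hx : 0 ≤ x) :
    expNeg (ENNReal.ofReal x) = ENNReal.ofReal (Real.exp (-x)) := by
  rw [expNeg, EReal.coe_ennreal_ofReal, max_eq_left hx, ← EReal.coe_neg, EReal.exp_coe]

lemma expNeg_add (s t : ℝ≥0∞) : expNeg (s + t) = expNeg s * expNeg t := by
  rw [expNeg, expNeg, expNeg, EReal.coe_ennreal_add, EReal.neg_add, sub_eq_add_neg,
    EReal.exp_add]
  · exact Or.inl (EReal.coe_ennreal_ne_bot s)
  · exact Or.inr (EReal.coe_ennreal_ne_bot t)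

lemma expNeg_antitone : Antitone expNeg := fun _ _ h =>
  EReal.exp_monotone (EReal.neg_le_neg_iff.2 (EReal.coe_ennreal_le_coe_ennreal_iff.2 h))

lemma expNeg_le_one (t : ℝ≥0∞) : expNeg t ≤ 1 := by
  simpa using expNeg_antitone (zero_le (a := t))

lemma continuous_expNeg : Continuous expNeg :=
  ENNReal.continuous_exp.comp (continuous_neg.comp continuous_coe_ennreal_ereal)

@[fun_prop]
lemma measurable_expNeg : Measurable expNeg := continuous_expNeg.measurable

lemma expNeg_sum {ι : Type*} (s : Finset ι) (f : ι → ℝ≥0∞) :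
    expNeg (∑ i ∈ s, f i) = ∏ i ∈ s, expNeg (f i) := by
  classical
  induction s using Finset.induction_on with
  | empty => simp
  | insert i s hi ih => rw [Finset.sum_insert hi, Finset.prod_insert hi, expNeg_add, ih]

lemma expNeg_nsmul (n : ℕ) (t : ℝ≥0∞) : expNeg (n * t) = expNeg t ^ n := by
  simpa using expNeg_sum (Finset.range n) (fun _ => t)

lemma expNeg_neg_log {x : ℝ} (h0 : 0 < x) (h1 : x ≤ 1) :
    expNeg (ENNReal.ofReal (-Real.log x)) = ENNReal.ofReal x := by
  rw [expNeg_ofReal (by simpa using Real.log_nonpos h0.le h1), neg_neg, Real.exp_log h0]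

lemma tendsto_expNeg_sum_range (f : ℕ → ℝ≥0∞) :
    Filter.Tendsto (fun n => ∏ j ∈ Finset.range n, expNeg (f j)) Filter.atTop
      (nhds (expNeg (∑' j, f j))) := by
  simp_rw [← expNeg_sum]
  exact (continuous_expNeg.tendsto _).comp (ENNReal.tendsto_nat_tsum f)

/-- If `T ≤ s + t` with `s` finite, then `exp (-t)` is at most `exp s * exp (-T)`. -/
lemma expNeg_le_of_le_add {T t : ℝ≥0∞} {s : ℝ} (hs : 0 ≤ s) (h : T ≤ ENNReal.ofReal s + t) :
    expNeg t ≤ ENNReal.ofReal (Real.exp s) * expNeg T := by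
  calc expNeg t = ENNReal.ofReal (Real.exp s) * (expNeg (ENNReal.ofReal s) * expNeg t) := by
        rw [expNeg_ofReal hs, ← mul_assoc, ← ENNReal.ofReal_mul (Real.exp_nonneg _),
          ← Real.exp_add]
        simp
    _ ≤ _ := by
        rw [← expNeg_add]
        gcongr
        exact expNeg_antitone h

/-! ### Laplace transforms and independence -/

section Independence

variable {Ω : Type*} [MeasurableSpace Ω] {P : Measure Ω}

/-- The Laplace transform of an infinite sum of independent variables. -/
lemma lintegral_expNeg_tsum [IsProbabilityMeasure P] {Y : ℕ → Ω → ℝ≥0∞} (hY : ∀ j, Measurable (Y j))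
    (hind : iIndepFun Y P) (w : ℕ → ℝ≥0∞)
    (hw : ∀ j, ∫⁻ ω, expNeg (Y j ω) ∂P = expNeg (w j)) :
    ∫⁻ ω, expNeg (∑' j, Y j ω) ∂P = expNeg (∑' j, w j) := by
  have hfin : ∀ n, ∫⁻ ω, ∏ j ∈ Finset.range n, expNeg (Y j ω) ∂P
      = ∏ j ∈ Finset.range n, expNeg (w j) := by
    intro n
    rw [Finset.prod_congr rfl fun j _ => (hw j).symm]
    exact lintegral_prod_eq_prod_lintegral_of_indepFun (Finset.range n)
      (fun j ω => expNeg (Y j ω)) (hind.comp (fun _ => expNeg) fun _ => measurable_expNeg)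
      (fun j => measurable_expNeg.comp (hY j))
  refine tendsto_nhds_unique ?_ (tendsto_expNeg_sum_range w)
  simp_rw [← hfin]
  refine tendsto_lintegral_of_dominated_convergence (fun _ => 1) (fun n => ?_) (fun n => ?_)
    (by simp) (Filter.Eventually.of_forall fun ω => tendsto_expNeg_sum_range _)
  · exact Finset.measurable_prod _ fun j _ => measurable_expNeg.comp (hY j)
  · exact Filter.Eventually.of_forall fun ω => Finset.prod_le_one' fun j _ => expNeg_le_one _

/-- In an independent family, each member is independent of all the others together. -/
lemma iIndepFun.indepFun_others {ι : Type*} {β : ι → Type*} [∀ i, MeasurableSpace (β i)]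
    {f : ∀ i, Ω → β i} (h : iIndepFun f P) (hf : ∀ i, Measurable (f i)) (i : ι) :
    IndepFun (f i) (fun ω (j : {j // j ≠ i}) => f j ω) P := by
  have := indep_iSup_of_disjoint (fun j => (hf j).comap_le) ((iIndepFun_iff_iIndep _ _ _).1 h)
    (S := {i}) (T := {i}ᶜ) disjoint_compl_right
  rw [IndepFun_iff_Indep]
  refine indep_of_indep_of_le_left (indep_of_indep_of_le_right this ?_) ?_
  · rw [← measurable_iff_comap_le]
    refine @measurable_pi_lambda _ _ _ (_) _ _ fun j => ?_
    rw [measurable_iff_comap_le]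
    exact le_iSup₂_of_le (f := fun i _ => MeasurableSpace.comap (f i) _) j.1 j.2 le_rfl
  · simp

end Independence

/-! ### Exponential gains -/

section Exponential

/-- This turns a threshold on the target gain into a Laplace functional of the interference. The
value `T = ∞` is allowed, since the interference is not known to be finite. -/
lemma rayleighGain_tail (T : ℝ≥0∞) {c : ℝ} (hc : 0 < c) :
    rayleighGain {x | T < ENNReal.ofReal (c * x)} = expNeg (T / ENNReal.ofReal c) := by
  have := isProbabilityMeasure_expMeasure one_pos
  induction T with
  | top => simp [ENNReal.top_div]
  | coe T =>
    have hset : {x : ℝ | (T : ℝ≥0∞) < ENNReal.ofReal (c * x)} = (Set.Iic (T / c : ℝ))ᶜ := by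
      ext x
      simp only [Set.mem_ofPred_eq, Set.mem_compl_iff, Set.mem_Iic, not_le]
      rw [ENNReal.lt_ofReal_iff_toReal_lt (by simp), ENNReal.coe_toReal, div_lt_iff₀' hc]
    have hT : (T : ℝ≥0∞) / ENNReal.ofReal c = ENNReal.ofReal (T / c) := by
      rw [ENNReal.ofReal_div_of_pos hc, ENNReal.ofReal_coe_nnreal]
    have h0 : (0 : ℝ) ≤ T / c := by positivity
    have hcdf := cdf_expMeasure_eq one_pos (T / c : ℝ)
    rw [cdf_eq_real, if_pos h0] at hcdf
    rw [hset, hT, expNeg_ofReal h0, rayleighGain, ← ofReal_measureReal,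
      probReal_compl_eq_one_sub measurableSet_Iic, hcdf]
    simp

/-- Tilting the density of rate `1` by `exp (-c x)` gives the density of rate `1 + c` up to the
factor `1 / (1 + c)`. -/
lemma lintegral_expNeg_rayleighGain {c : ℝ} (hc : 0 ≤ c) :
    ∫⁻ x, expNeg (ENNReal.ofReal (c * x)) ∂rayleighGain = ENNReal.ofReal (1 / (1 + c)) := by
  have h1 : (0 : ℝ) < 1 + c := by linarith
  have hd : rayleighGain = volume.withDensity (exponentialPDF 1) := rfl
  have hm : ∀ r, Measurable (exponentialPDF r) := fun r =>
    (measurable_exponentialPDFReal r).ennreal_ofReal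
  rw [hd, lintegral_withDensity_eq_lintegral_mul _ (hm 1) (by fun_prop)]
  have : ∀ x, (exponentialPDF 1 * fun x => expNeg (ENNReal.ofReal (c * x))) x
      = ENNReal.ofReal (1 / (1 + c)) * exponentialPDF (1 + c) x := by
    intro x
    rcases lt_or_ge x 0 with hx | hx
    · simp [exponentialPDF_of_neg hx]
    · rw [Pi.mul_apply, exponentialPDF_of_nonneg hx, exponentialPDF_of_nonneg hx,
        expNeg_ofReal (mul_nonneg hc hx), ← ENNReal.ofReal_mul (by positivity),
        ← ENNReal.ofReal_mul (by positivity)]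
      congr 1
      rw [one_mul, ← Real.exp_add]
      field_simp
      ring_nf
  rw [lintegral_congr this, lintegral_const_mul _ (hm _),
    lintegral_exponentialPDF_eq_one h1, mul_one]

end Exponential

/-! ### Poisson counts -/

section PoissonLaw

lemma tsum_poissonMeasure_singleton (r : ℝ≥0) : ∑' k : ℕ, poissonMeasure r {k} = 1 := by
  rw [← measure_iUnion (fun i j hij => Set.disjoint_singleton.2 hij)
    fun _ => measurableSet_singleton _, Set.iUnion_of_singleton, measure_univ]

/-- The Poisson weights of the finite values already sum to one, so the value `⊤` of the count has
no mass. -/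
lemma lintegral_of_poisson_law {Ω : Type*} [MeasurableSpace Ω] {P : Measure Ω}
    [IsProbabilityMeasure P] {N : Ω → ℕ∞} (hN : Measurable N) {r : ℝ≥0}
    (hlaw : ∀ k : ℕ, P {ω | N ω = k} = poissonMeasure r {k}) (f : ℕ∞ → ℝ≥0∞) :
    ∫⁻ ω, f (N ω) ∂P = ∑' k : ℕ, f k * poissonMeasure r {k} := by
  have hcoe : Measurable ((↑) : ℕ → ℕ∞) := Measurable.of_discrete
  have := Measure.isProbabilityMeasure_map (μ := P) hN.aemeasurable
  have hsing : ∀ k : ℕ, P.map N {(k : ℕ∞)} = poissonMeasure r {k} := fun k => by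
    rw [Measure.map_apply hN (measurableSet_singleton _)]
    exact hlaw k
  have htop : P.map N {⊤} = 0 := by
    rw [← prob_compl_eq_one_iff (measurableSet_singleton _)]
    have : ({⊤}ᶜ : Set ℕ∞) = ⋃ k : ℕ, {(k : ℕ∞)} := by
      ext x
      induction x <;> simp
    rw [this, measure_iUnion (fun i j hij => Set.disjoint_singleton.2 (by simpa using hij))
      fun _ => measurableSet_singleton _]
    simp_rw [hsing]
    exact tsum_poissonMeasure_singleton r
  have hmap : P.map N = (poissonMeasure r).map (↑) := by
    refine Measure.ext_of_singleton fun x => ?_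
    rw [Measure.map_apply hcoe (measurableSet_singleton _)]
    induction x with
    | top =>
      rw [htop]
      have : ((↑) : ℕ → ℕ∞) ⁻¹' {⊤} = ∅ := by ext; simp
      simp [this]
    | coe k =>
      rw [hsing]
      congr 1
      ext; simp
  calc ∫⁻ ω, f (N ω) ∂P = ∫⁻ x, f x ∂(P.map N) := (lintegral_map .of_discrete hN).symm
    _ = ∫⁻ k : ℕ, f k ∂(poissonMeasure r) := by
      rw [hmap, lintegral_map .of_discrete hcoe]
    _ = _ := lintegral_countable' _

lemma tsum_pow_mul_poissonMeasure (r : ℝ≥0) {z : ℝ≥0∞} (hz : z ≤ 1) :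
    ∑' k : ℕ, z ^ k * poissonMeasure r {k} = expNeg (r * (1 - z)) := by
  lift z to ℝ≥0 using ne_top_of_le_ne_top ENNReal.one_ne_top hz
  have hz' : (z : ℝ) ≤ 1 := by exact_mod_cast hz
  have h0 : (0 : ℝ) ≤ r * (1 - z) := mul_nonneg r.coe_nonneg (by linarith)
  have hexp : (r : ℝ≥0∞) * (1 - z) = ENNReal.ofReal (r * (1 - z)) := by
    rw [ENNReal.ofReal_mul r.coe_nonneg, ENNReal.ofReal_sub _ z.coe_nonneg]
    simp
  have : ∀ k : ℕ, (z : ℝ≥0∞) ^ k * poissonMeasure r {k}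
      = expNeg (r * (1 - z)) * poissonMeasure (r * z) {k} := by
    intro k
    rw [poissonMeasure_singleton, poissonMeasure_singleton, hexp, expNeg_ofReal h0,
      ← ENNReal.ofReal_coe_nnreal, ← ENNReal.ofReal_pow z.coe_nonneg,
      ← ENNReal.ofReal_mul (by positivity), ← ENNReal.ofReal_mul (by positivity)]
    congr 1
    have he : Real.exp (-r : ℝ) = Real.exp (-(r * (1 - z))) * Real.exp (-(r * z : ℝ≥0)) := by
      rw [← Real.exp_add, NNReal.coe_mul]
      ring_nf
    rw [he, NNReal.coe_mul, mul_pow]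
    ring
  rw [tsum_congr this, ENNReal.tsum_mul_left, tsum_poissonMeasure_singleton, mul_one]

variable {Ω : Type*} [MeasurableSpace Ω] {P : Measure Ω} [IsProbabilityMeasure P] {N : Ω → ℕ∞}
  {r : ℝ≥0}

lemma lintegral_expNeg_mul_poisson (hN : Measurable N)
    (hlaw : ∀ k : ℕ, P {ω | N ω = k} = poissonMeasure r {k}) (c : ℝ≥0∞) :
    ∫⁻ ω, expNeg (c * N ω) ∂P = expNeg (r * (1 - expNeg c)) := by
  rw [lintegral_of_poisson_law hN hlaw fun n => expNeg (c * n),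
    ← tsum_pow_mul_poissonMeasure r (expNeg_le_one c)]
  refine tsum_congr fun k => ?_
  rw [mul_comm c, ENat.toENNReal_coe, expNeg_nsmul]

/-- The one-cell Palm identity: `(k + 1) P(N = k + 1) = r P(N = k)`, so removing one point from the
size-biased count leaves a Poisson count. The truncated `N - 1` is harmless at `N = 0`, where the
factor `N` vanishes. -/
lemma lintegral_mul_expNeg_poisson (hN : Measurable N)
    (hlaw : ∀ k : ℕ, P {ω | N ω = k} = poissonMeasure r {k}) (c : ℝ≥0∞) :
    ∫⁻ ω, N ω * expNeg (c * (N ω - 1 : ℕ∞)) ∂P = r * expNeg (r * (1 - expNeg c)) := by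
  rw [lintegral_of_poisson_law hN hlaw fun n => n * expNeg (c * (n - 1 : ℕ∞)),
    tsum_eq_zero_add' ENNReal.summable, ← tsum_pow_mul_poissonMeasure r (expNeg_le_one c),
    ← ENNReal.tsum_mul_left]
  simp only [Nat.cast_zero, ENat.toENNReal_zero, zero_mul, zero_add]
  refine tsum_congr fun k => ?_
  have h1 : ((k + 1 : ℕ) : ℕ∞) - 1 = k := by
    norm_cast
  have h2 : ((k + 1 : ℕ) : ℝ≥0∞) * poissonMeasure r {k + 1} = r * poissonMeasure r {k} := by
    rw [poissonMeasure_singleton, poissonMeasure_singleton, ← ENNReal.ofReal_natCast,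
      ← ENNReal.ofReal_coe_nnreal (p := r), ← ENNReal.ofReal_mul (by positivity),
      ← ENNReal.ofReal_mul r.coe_nonneg]
    congr 1
    rw [Nat.factorial_succ, pow_succ]
    push_cast
    field_simp
  rw [h1, mul_comm c, ENat.toENNReal_coe, ENat.toENNReal_coe, expNeg_nsmul,
    mul_right_comm, h2]
  ring

/-- A Palm formula for a sequence of independent Poisson counts with a common mean. -/
lemma lintegral_cell_counts {N : ℕ → Ω → ℕ∞} (hN : ∀ t, Measurable (N t))
    (hlaw : ∀ t, ∀ k : ℕ, P {ω | N t ω = k} = poissonMeasure r {k}) (hind : iIndepFun N P)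
    (c : ℕ → ℝ≥0∞) (k : ℕ) :
    ∫⁻ ω, N k ω * expNeg (c k * (N k ω - 1 : ℕ∞)) *
        expNeg (∑' t, if t = k then 0 else c t * N t ω) ∂P
      = r * expNeg (r * ∑' t, (1 - expNeg (c t))) := by
  have hmeas : ∀ g : ℕ∞ → ℝ≥0∞, Measurable g := fun _ => .of_discrete
  let G : ({t // t ≠ k} → ℕ∞) → ℝ≥0∞ :=
    fun n => expNeg (∑' t, if h : t = k then 0 else c t * n ⟨t, h⟩)
  have hG : Measurable G := by
    refine measurable_expNeg.comp (Measurable.tsum fun t => ?_)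
    by_cases h : t = k
    · simp [h]
    · simp only [h, dite_false]
      exact (hmeas fun n => c t * n).comp (measurable_pi_apply _)
  have hsplit : IndepFun (fun ω => (N k ω : ℝ≥0∞) * expNeg (c k * (N k ω - 1 : ℕ∞)))
      (fun ω => expNeg (∑' t, if t = k then 0 else c t * N t ω)) P := by
    have := (iIndepFun.indepFun_others hind hN k).comp
      (hmeas fun n => n * expNeg (c k * (n - 1 : ℕ∞))) hG
    exact this
  have hY : ∀ t, Measurable fun ω => if t = k then (0 : ℝ≥0∞) else c t * N t ω := fun t =>
    (hmeas fun n => if t = k then 0 else c t * n).comp (hN t)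
  have hmul := lintegral_mul_eq_lintegral_mul_lintegral_of_indepFun
    ((hmeas fun n => n * expNeg (c k * (n - 1 : ℕ∞))).comp (hN k))
    (measurable_expNeg.comp (Measurable.tsum hY)) hsplit
  simp only [Pi.mul_apply, Function.comp_apply] at hmul
  rw [hmul, lintegral_mul_expNeg_poisson (hN k) (hlaw k),
    lintegral_expNeg_tsum hY
      (hind.comp (fun t n => if t = k then 0 else c t * n) fun t => hmeas _)
      (fun t => if t = k then 0 else r * (1 - expNeg (c t)))
      fun t => ?_, mul_assoc, ← expNeg_add,
      -- The Palm identity leaves the full exponent of cell `k`, which supplies exactly the term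
      -- missing from the sum over the other cells.
      ENNReal.tsum_eq_add_tsum_ite (f := fun t => 1 - expNeg (c t)) k, mul_add,
      ← ENNReal.tsum_mul_left]
  · congr 4
    ext t
    split_ifs <;> simp
  · split_ifs
    · simp
    · exact lintegral_expNeg_mul_poisson (hN t) (hlaw t) (c t)

end PoissonLaw

/-! ### Grouping points by cells -/

section Cells

open Classical in
lemma tsum_ite_mem_comp {ι : Type*} (A : Set ι) (l : ι → ℕ) (c : ℕ → ℝ≥0∞) :
    ∑' j, (if j ∈ A then c (l j) else 0) = ∑' t, c t * ({j | j ∈ A ∧ l j = t}.encard : ℝ≥0∞) := by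
  have h1 : ∀ j, (if j ∈ A then c (l j) else 0)
      = ∑' t, Set.indicator {j | j ∈ A ∧ l j = t} (fun _ => c t) j := by
    intro j
    rw [tsum_eq_single (l j)]
    · simp [Set.indicator_apply]
    · intro t ht
      simp [Ne.symm ht]
  rw [tsum_congr h1, ENNReal.tsum_comm]
  refine tsum_congr fun t => ?_
  rw [← tsum_subtype, ENNReal.tsum_set_const, mul_comm]

/-- Sum, over the points of one cell, of a functional of the other points that depends on their
cells only. -/
lemma tsum_cell_eq (l : ℕ → ℕ) (c : ℕ → ℝ≥0∞) (k : ℕ) :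
    ∑' i, (if l i = k then expNeg (∑' j, if j = i then 0 else c (l j)) else 0)
      = ({i | l i = k}.encard : ℝ≥0∞) * expNeg (c k * ({i | l i = k}.encard - 1 : ℕ∞)) *
        expNeg (∑' t, if t = k then 0 else c t * {i | l i = t}.encard) := by
  classical
  rw [mul_assoc, ← expNeg_add, ← ENNReal.tsum_set_const, tsum_subtype {i | l i = k} fun _ => _]
  refine tsum_congr fun i => ?_
  rw [Set.indicator_apply]
  by_cases hik : l i = k
  swap
  · simp [hik]
  have hall : ∑' j, (if j = i then 0 else c (l j))
      = ∑' t, c t * ({j | j ≠ i ∧ l j = t}.encard : ℝ≥0∞) := by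
    refine Eq.trans (tsum_congr fun j => ?_) (tsum_ite_mem_comp {j | j ≠ i} l c)
    by_cases h : j = i <;> simp [h]
  -- Only the cell of the target `i` loses a point when `i` is excluded.
  have hk : {j | j ≠ i ∧ l j = k}.encard = {j | l j = k}.encard - 1 := by
    rw [← Set.encard_sdiff_singleton_of_mem (a := i) (s := {j | l j = k}) hik]
    congr 1
    ext j
    simp [and_comm]
  have ht : ∀ t, t ≠ k → {j | j ≠ i ∧ l j = t} = {j | l j = t} := by
    intro t ht
    ext j
    simp only [Set.mem_ofPred_eq, and_iff_right_iff_imp]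
    rintro rfl rfl
    exact ht hik
  rw [hall, ENNReal.tsum_eq_add_tsum_ite k, hk, if_pos hik,
    if_pos (show i ∈ {i | l i = k} from hik)]
  congr 3
  ext t
  split_ifs with h
  · rfl
  · rw [ht t h]

end Cells

/-! ### Poisson processes seen through a countable partition -/

section PoissonProcess

variable {Ω E : Type*} [MeasurableSpace Ω] [MeasurableSpace E] {P : Measure Ω} {Λ : Measure E}
  {X : ℕ → Ω → E}

lemma measurable_encard_preimage (hX : ∀ i, Measurable (X i)) {B : Set E}
    (hB : MeasurableSet B) : Measurable fun ω => {i : ℕ | X i ω ∈ B}.encard := by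
  have h : Measurable fun ω => ({i : ℕ | X i ω ∈ B}.encard : ℝ≥0∞) := by
    have : (fun ω => ({i : ℕ | X i ω ∈ B}.encard : ℝ≥0∞))
        = fun ω => ∑' i, (X i ⁻¹' B).indicator (fun _ => 1) ω := by
      ext ω
      rw [← ENNReal.tsum_set_one, tsum_subtype {i : ℕ | X i ω ∈ B} fun _ => (1 : ℝ≥0∞)]
      rfl
    rw [this]
    exact Measurable.tsum fun i => measurable_const.indicator (hX i hB)
  refine measurable_to_countable' fun n => ?_
  convert h (measurableSet_singleton (n : ℝ≥0∞)) using 1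
  ext ω
  simp

/-- A Palm formula for a Poisson process that is observed through a partition into cells of
common intensity. -/
lemma IsPoissonProcess.lintegral_cell [IsProbabilityMeasure P] (h : IsPoissonProcess P Λ X)
    {q : E → ℕ} (hq : Measurable q) {r : ℝ≥0} (hr : ∀ t, Λ (q ⁻¹' {t}) = r) (c : ℕ → ℝ≥0∞)
    (k : ℕ) :
    ∫⁻ ω, ∑' i, (if q (X i ω) = k then
        expNeg (∑' j, if j = i then 0 else c (q (X j ω))) else 0) ∂P
      = r * expNeg (r * ∑' t, (1 - expNeg (c t))) := by
  have hB : ∀ t, MeasurableSet (q ⁻¹' {t}) := fun t => hq (measurableSet_singleton t)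
  simp_rw [fun ω => tsum_cell_eq (fun i => q (X i ω)) c k]
  refine lintegral_cell_counts (N := fun t ω => {i : ℕ | X i ω ∈ q ⁻¹' {t}}.encard)
    (fun t => measurable_encard_preimage h.measurable (hB t)) (fun t n => ?_) ?_ c k
  · rw [h.count_law _ (hB t) (by simp [hr]) n, hr, ENNReal.toNNReal_coe]
  · rw [iIndepFun_iff_finset]
    -- Independence of the counts is given for families indexed by `Fin n`; a finite set of cells is
    -- enumerated to use it.
    intro S
    have := h.count_indep S.card (fun j => q ⁻¹' {(S.equivFin.symm j : ℕ)}) (fun j => hB _)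
      fun j j' hjj => Set.disjoint_left.2 fun x hx hx' => hjj <|
        S.equivFin.symm.injective <| Subtype.ext <| by
          rw [← Set.mem_singleton_iff.1 hx, ← Set.mem_singleton_iff.1 hx']
    have := this.precomp S.equivFin.injective
    simpa [Finset.restrict_def] using this

/-- A Poisson process has almost surely no point in a null set. -/
lemma IsPoissonProcess.ae_notMem [IsProbabilityMeasure P] (h : IsPoissonProcess P Λ X)
    {B : Set E} (hB : MeasurableSet B) (h0 : Λ B = 0) : ∀ᵐ ω ∂P, ∀ i, X i ω ∉ B := by
  have h1 := h.count_law B hB (by simp [h0]) 0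
  rw [h0, ENNReal.toNNReal_zero, poissonMeasure_singleton] at h1
  have h2 : MeasurableSet {ω | {i : ℕ | X i ω ∈ B}.encard = ((0 : ℕ) : ℕ∞)} :=
    measurable_encard_preimage h.measurable hB (measurableSet_singleton _)
  have h3 := (mem_ae_iff_prob_eq_one h2).2 (by rw [h1]; simp)
  filter_upwards [h3] with ω hω i hi
  have : {i : ℕ | X i ω ∈ B} = ∅ := by simpa using hω
  exact (this ▸ (show i ∈ {i : ℕ | X i ω ∈ B} from hi) : i ∈ (∅ : Set ℕ))

end PoissonProcess

/-- For independent variables, the probability of a joint event is the average, over one of them,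
of the probability of its sections. -/
lemma ProbabilityTheory.IndepFun.measure_mem_prod {Ω E F : Type*} [MeasurableSpace Ω]
    [MeasurableSpace E] [MeasurableSpace F] {P : Measure Ω} [IsProbabilityMeasure P]
    {U : Ω → E} {V : Ω → F} (h : IndepFun U V P) (hU : Measurable U) (hV : Measurable V)
    {A : Set (E × F)} (hA : MeasurableSet A) :
    P {ω | (U ω, V ω) ∈ A} = ∫⁻ ω, P {ω' | (U ω, V ω') ∈ A} ∂P := by
  have hmap := (indepFun_iff_map_prod_eq_prod_map_map hU.aemeasurable hV.aemeasurable).1 h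
  have := Measure.isProbabilityMeasure_map (μ := P) hV.aemeasurable
  calc P {ω | (U ω, V ω) ∈ A} = (P.map fun ω => (U ω, V ω)) A :=
        (Measure.map_apply (hU.prodMk hV) hA).symm
    _ = ∫⁻ ω, P.map V (Prod.mk (U ω) ⁻¹' A) ∂P := by
        rw [hmap, Measure.prod_apply hA, lintegral_map (measurable_measure_prodMk_left hA) hU]
    _ = _ := lintegral_congr fun ω =>
        Measure.map_apply hV (measurable_prodMk_left hA)

/-! ### Fading, modes and resource blocks at fixed locations -/

/-- The exponent by which an interferer, on the same resource block with probability `p`, whose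
gain is scaled by `θ` relative to the target, lowers the probability of discovery. -/
noncomputable def interferenceExponent (p θ : ℝ) : ℝ≥0∞ :=
  ENNReal.ofReal (-Real.log (1 - p * (θ / (1 + θ))))

/-- The logarithm turns the infinite product over interferers into a sum in `[0, ∞]`; `p < 1` keeps
its argument positive. -/
lemma expNeg_interferenceExponent {p θ : ℝ} (hp0 : 0 ≤ p) (hp1 : p < 1) (hθ : 0 ≤ θ) :
    expNeg (interferenceExponent p θ) = ENNReal.ofReal (1 - p * (θ / (1 + θ))) := by
  have h1 : θ / (1 + θ) ≤ 1 := by rw [div_le_one (by positivity)]; linarith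
  have h0 : 0 ≤ θ / (1 + θ) := by positivity
  exact expNeg_neg_log (by nlinarith) (by nlinarith)

namespace HelloSlot

variable {Ω : Type*} [MeasurableSpace Ω] {P : Measure Ω} {lam : ℝ} {M : ℕ} {ρ : ℝ} {ν : Measure ℝ}

/-- The mode, the resource block and the gains of node `i`. -/
def mark (s : HelloSlot P lam M ρ ν) (i : ℕ) (ω : Ω) : (Bool × Fin M) × (ℝ × ℝ) :=
  ((s.tx i ω, s.rb i ω), (s.h i ω, s.g i ω))

@[fun_prop]
lemma measurable_mark (s : HelloSlot P lam M ρ ν) (i : ℕ) : Measurable (s.mark i) :=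
  ((s.measurable_tx i).prodMk (s.measurable_rb i)).prodMk
    ((s.measurable_h i).prodMk (s.measurable_g i))

lemma measure_mode (s : HelloSlot P lam M ρ ν) (i : ℕ) (m : Fin M) :
    P {ω | s.tx i ω = true ∧ s.rb i ω = m} = ENNReal.ofReal (ρ / M) := by
  have := (s.indep_tx_rb i).measure_inter_preimage_eq_mul {true} {m} (measurableSet_singleton _)
    (measurableSet_singleton _)
  have hM : (0 : ℝ) < M := by exact_mod_cast Fin.pos m
  calc P {ω | s.tx i ω = true ∧ s.rb i ω = m} = _ := this
    _ = ENNReal.ofReal ρ * (M : ℝ≥0∞)⁻¹ := by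
        rw [← s.law_tx i, ← s.law_rb i m]; rfl
    _ = _ := by
        rw [ENNReal.ofReal_div_of_pos hM, ENNReal.ofReal_natCast, div_eq_mul_inv]

/-- The power that node `j` contributes on the resource block `m`, if its path gain is `c`. -/
noncomputable def received (m : Fin M) (c : ℝ) (z : (Bool × Fin M) × (ℝ × ℝ)) : ℝ≥0∞ :=
  if z.1.1 = true ∧ z.1.2 = m then ENNReal.ofReal (c * z.2.2) else 0

@[fun_prop]
lemma measurable_received (m : Fin M) (c : ℝ) : Measurable (received m c) := by
  refine Measurable.ite ?_ (by fun_prop) measurable_const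
  exact (measurableSet_eq_fun (by fun_prop) measurable_const).inter
    (measurableSet_eq_fun (by fun_prop) measurable_const)

lemma mul_received (m : Fin M) (c : ℝ) {a : ℝ} (ha : 0 ≤ a) (z : (Bool × Fin M) × (ℝ × ℝ)) :
    ENNReal.ofReal a * received m c z = received m (a * c) z := by
  unfold received
  split_ifs
  · rw [← ENNReal.ofReal_mul ha, mul_assoc]
  · simp

/-- Off the block the node contributes the factor `1`; on it, by independence of mode and gain, the
Laplace transform `1 / (1 + θ)`. -/
lemma lintegral_expNeg_received [IsProbabilityMeasure P] (s : HelloSlot P lam M ρ rayleighGain)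
    (hρ0 : 0 ≤ ρ) (hp : ρ / M < 1) (m : Fin M) {θ : ℝ} (hθ : 0 ≤ θ) (j : ℕ) :
    ∫⁻ ω, expNeg (received m θ (s.mark j ω)) ∂P = expNeg (interferenceExponent (ρ / M) θ) := by
  have hp0 : 0 ≤ ρ / M := by positivity
  let A : Set (Bool × Fin M) := {z | z.1 = true ∧ z.2 = m}
  let B := {ω | s.tx j ω = true ∧ s.rb j ω = m}
  have hBm : MeasurableSet B :=
    (s.measurable_tx j (measurableSet_singleton true)).inter
      (s.measurable_rb j (measurableSet_singleton m))
  have hsplit : ∀ ω, expNeg (received m θ (s.mark j ω)) = Bᶜ.indicator 1 ω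
      + B.indicator 1 ω * expNeg (ENNReal.ofReal (θ * s.g j ω)) := by
    intro ω
    by_cases h : s.tx j ω = true ∧ s.rb j ω = m
    · have hB : ω ∈ B := h
      simp [received, mark, h, hB]
    · have hB : ω ∉ B := h
      simp [received, mark, h, hB]
  have hind : IndepFun (B.indicator (1 : Ω → ℝ≥0∞))
      (fun ω => expNeg (ENNReal.ofReal (θ * s.g j ω))) P := by
    have := (s.indep_mode_gain j).comp (φ := A.indicator (1 : Bool × Fin M → ℝ≥0∞))
      (ψ := fun y : ℝ × ℝ => expNeg (ENNReal.ofReal (θ * y.2)))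
      (measurable_one.indicator (Set.toFinite A).measurableSet) (by fun_prop)
    exact this
  have hgm := s.measurable_g j
  have hmul := lintegral_mul_eq_lintegral_mul_lintegral_of_indepFun
    ((measurable_one (α := ℝ≥0∞)).indicator hBm) (by fun_prop) hind
  simp only [Pi.mul_apply] at hmul
  have hg : ∫⁻ ω, expNeg (ENNReal.ofReal (θ * s.g j ω)) ∂P = ENNReal.ofReal (1 / (1 + θ)) := by
    exact (lintegral_map (f := fun x => expNeg (ENNReal.ofReal (θ * x))) (by fun_prop) hgm).symm.trans
      ((congrArg (fun μ => ∫⁻ x, expNeg (ENNReal.ofReal (θ * x)) ∂μ) (s.law_g j)).trans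
        (lintegral_expNeg_rayleighGain hθ))
  rw [lintegral_congr hsplit, lintegral_add_left (measurable_one.indicator hBm.compl), hmul, hg,
    lintegral_indicator_one hBm, lintegral_indicator_one hBm.compl, prob_compl_eq_one_sub hBm,
    s.measure_mode j m, expNeg_interferenceExponent hp0 hp hθ, ← ENNReal.ofReal_one,
    ← ENNReal.ofReal_sub _ hp0, ← ENNReal.ofReal_mul hp0,
    ← ENNReal.ofReal_add (by linarith) (by positivity)]
  congr 1
  field_simp
  ring

/-- The probability that node `i` transmits on the resource block `m` and overcomes the
interference on it, for fixed path gains `c`. -/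
lemma measure_decoded [IsProbabilityMeasure P] (s : HelloSlot P lam M ρ rayleighGain)
    (hρ0 : 0 ≤ ρ) (hp : ρ / M < 1) {ξ noise : ℝ} (hξ : 0 ≤ ξ)
    {c : ℕ → ℝ} (hc : ∀ j, 0 < c j) (i : ℕ) (m : Fin M) :
    P {ω | (s.tx i ω = true ∧ s.rb i ω = m) ∧ ENNReal.ofReal ξ *
        ((∑' j, if j = i then 0 else received m (c j) (s.mark j ω)) + ENNReal.ofReal noise)
          < ENNReal.ofReal (c i * s.h i ω)}
      = ENNReal.ofReal (ρ / M) * (expNeg (ENNReal.ofReal (ξ * noise / c i)) *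
        expNeg (∑' j, if j = i then 0 else interferenceExponent (ρ / M) (ξ / c i * c j))) := by
  set J : Ω → ℝ≥0∞ := fun ω => ∑' j, if j = i then 0 else received m (c j) (s.mark j ω) with hJ
  have hterm : ∀ (a : ℕ → ℝ) j,
      Measurable fun z => if j = i then 0 else received m (a j) z := by
    intro a j
    split_ifs <;> fun_prop
  have hJm : Measurable J := Measurable.tsum fun j => (hterm c j).comp (s.measurable_mark j)
  let G : ({j // j ≠ i} → (Bool × Fin M) × (ℝ × ℝ)) → ℝ≥0∞ := fun z =>
    ∑' j, if h : j = i then 0 else received m (c j) (z ⟨j, h⟩)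
  have hG : Measurable G := by
    refine Measurable.tsum fun j => ?_
    by_cases h : j = i
    · simp [h]
    · simp only [h, dite_false]
      exact (measurable_received m (c j)).comp (measurable_pi_apply _)
  -- The interference on the fixed block `m` involves only the marks of the other nodes, so it can
  -- be frozen while averaging over the mark of `i`.
  have hind : IndepFun J (s.mark i) P :=
    ((iIndepFun.indepFun_others s.indep_nodes s.measurable_mark i).comp measurable_id hG).symm
  have hslice := hind.measure_mem_prod hJm (s.measurable_mark i)
    (A := {q : ℝ≥0∞ × ((Bool × Fin M) × (ℝ × ℝ)) | (q.2.1.1 = true ∧ q.2.1.2 = m) ∧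
      ENNReal.ofReal ξ * (q.1 + ENNReal.ofReal noise) < ENNReal.ofReal (c i * q.2.2.1)})
    (((measurableSet_eq_fun (by fun_prop) measurable_const).inter
      (measurableSet_eq_fun (by fun_prop) measurable_const)).inter
      (measurableSet_lt
        (f := fun q : ℝ≥0∞ × ((Bool × Fin M) × (ℝ × ℝ)) =>
          ENNReal.ofReal ξ * (q.1 + ENNReal.ofReal noise))
        (g := fun q => ENNReal.ofReal (c i * q.2.2.1)) (by fun_prop) (by fun_prop)))
  have hcond : ∀ ω, P {ω' | (s.tx i ω' = true ∧ s.rb i ω' = m) ∧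
      ENNReal.ofReal ξ * (J ω + ENNReal.ofReal noise) < ENNReal.ofReal (c i * s.h i ω')}
      = ENNReal.ofReal (ρ / M) * (expNeg (ENNReal.ofReal (ξ * noise / c i)) *
        expNeg (∑' j, if j = i then 0 else received m (ξ / c i * c j) (s.mark j ω))) := by
    intro ω
    set T := ENNReal.ofReal ξ * (J ω + ENNReal.ofReal noise) with hT
    have hJω : J ω = ∑' j, if j = i then 0 else received m (c j) (s.mark j ω) := rfl
    have hTm : MeasurableSet {x : ℝ | T < ENNReal.ofReal (c i * x)} :=
      measurableSet_lt measurable_const (by fun_prop)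
    have hprod := (s.indep_mode_gain i).measure_inter_preimage_eq_mul {(true, m)}
      (Prod.fst ⁻¹' {x : ℝ | T < ENNReal.ofReal (c i * x)}) (measurableSet_singleton _)
      (measurable_fst hTm)
    have hgain : P (s.h i ⁻¹' {x : ℝ | T < ENNReal.ofReal (c i * x)})
        = expNeg (T / ENNReal.ofReal (c i)) := by
      rw [← rayleighGain_tail T (hc i), ← Measure.map_apply (s.measurable_h i) hTm]
      exact congrArg (fun μ : Measure ℝ => μ _) (s.law_h i)
    have hTdiv : T / ENNReal.ofReal (c i) = ENNReal.ofReal (ξ * noise / c i) +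
        ∑' j, if j = i then 0 else received m (ξ / c i * c j) (s.mark j ω) := by
      rw [hT, ENNReal.mul_div_right_comm, ← ENNReal.ofReal_div_of_pos (hc i), mul_add, add_comm,
        ← ENNReal.ofReal_mul (div_nonneg hξ (hc i).le), hJω, ← ENNReal.tsum_mul_left]
      congr 2
      · ring_nf
      · ext j
        split_ifs
        · simp
        · exact mul_received m (c j) (div_nonneg hξ (hc i).le) _
    rw [← expNeg_add, ← hTdiv, ← hgain, ← s.measure_mode i m]
    have hmode : {ω' | s.tx i ω' = true ∧ s.rb i ω' = m}
        = (fun ω' => (s.tx i ω', s.rb i ω')) ⁻¹' {(true, m)} := by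
      ext ω'; simp
    rw [hmode]
    refine Eq.trans (congrArg P ?_) hprod
    ext ω'; simp
  have hY : ∀ j, Measurable fun ω =>
      if j = i then 0 else received m (ξ / c i * c j) (s.mark j ω) := fun j =>
    (hterm (fun j => ξ / c i * c j) j).comp (s.measurable_mark j)
  refine hslice.trans ((lintegral_congr hcond).trans ?_)
  have hYm : Measurable fun ω =>
      expNeg (∑' j, if j = i then 0 else received m (ξ / c i * c j) (s.mark j ω)) :=
    measurable_expNeg.comp (Measurable.tsum hY)
  rw [lintegral_const_mul _ (hYm.const_mul _), lintegral_const_mul _ hYm]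
  congr 2
  refine lintegral_expNeg_tsum hY (s.indep_nodes.comp _ (hterm fun j => ξ / c i * c j)) _
    fun j => ?_
  split_ifs
  · simp
  · exact s.lintegral_expNeg_received hρ0 hp m
      (mul_nonneg (div_nonneg hξ (hc i).le) (hc j).le) j

end HelloSlot

/-! ### Averaging over the locations -/

namespace HelloSlot

variable {Ω : Type*} [MeasurableSpace Ω] {P : Measure Ω} {lam : ℝ} {M : ℕ} {ρ : ℝ} {ν : Measure ℝ}

/-- The condition on the locations, the mode of the typical node, and the marks of all nodes
under which node `i` is discovered. -/
def discoverySet (M : ℕ) (α noise ξ : ℝ) (i : ℕ) :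
    Set ((ℕ → Plane) × (Bool × (ℕ → (Bool × Fin M) × (ℝ × ℝ)))) :=
  {q | q.2.1 = false ∧ (q.2.2 i).1.1 = true ∧ ENNReal.ofReal ξ *
    ((∑' j, if j = i then 0 else received (q.2.2 i).1.2 (‖q.1 j‖ ^ (-α)) (q.2.2 j)) +
      ENNReal.ofReal noise) < ENNReal.ofReal (‖q.1 i‖ ^ (-α) * (q.2.2 i).2.1)}

lemma measurableSet_discoverySet (M : ℕ) (α noise ξ : ℝ) (i : ℕ) :
    MeasurableSet (discoverySet M α noise ξ i) := by
  have hgain : Measurable fun q : (ℕ → Plane) × (Bool × (ℕ → (Bool × Fin M) × (ℝ × ℝ))) =>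
      ENNReal.ofReal (‖q.1 i‖ ^ (-α) * (q.2.2 i).2.1) := by fun_prop
  refine (measurableSet_eq_fun (by fun_prop) measurable_const).inter
    ((measurableSet_eq_fun (by fun_prop) measurable_const).inter
      (measurableSet_lt (Measurable.const_mul (Measurable.add_const
        (Measurable.tsum fun j => ?_) _) _) hgain))
  split_ifs
  · exact measurable_const
  · refine Measurable.ite ?_ (by fun_prop) measurable_const
    exact (measurableSet_eq_fun (by fun_prop) measurable_const).inter
      (measurableSet_eq_fun (by fun_prop) (by fun_prop))

/-- Clearing the denominator is legitimate even when it is `0` or `∞`, because the threshold is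
neither. -/
lemma mem_discoverySet_iff (s : HelloSlot P lam M ρ ν) {α noise ξ : ℝ} (hξ : 0 < ξ) (i : ℕ)
    (ω : Ω) :
    ((fun j => s.X j ω), (s.tx₀ ω, fun j => s.mark j ω)) ∈ discoverySet M α noise ξ i ↔
      s.tx₀ ω = false ∧ s.tx i ω = true ∧ ENNReal.ofReal ξ < s.sinr α noise i ω := by
  have hI : s.interference α i ω = ∑' j, if j = i then 0 else
      received (s.rb i ω) (‖s.X j ω‖ ^ (-α)) (s.mark j ω) := by
    refine tsum_congr fun j => ?_
    by_cases h : j = i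
    · simp [h]
    · simp only [received, mark, h, ne_eq, not_false_eq_true, true_and, if_false]
      congr
  rw [sinr, ENNReal.lt_div_iff_mul_lt (Or.inr ENNReal.ofReal_ne_top)
    (Or.inr (ENNReal.ofReal_pos.2 hξ).ne'), hI]
  rfl

/-- The conditional probability, given the locations `x`, that node `i` is discovered. -/
lemma measure_discoverySet [IsProbabilityMeasure P] (s : HelloSlot P lam M ρ rayleighGain)
    (hM : 0 < M) (hρ0 : 0 ≤ ρ) (hρ1 : ρ < 1) {α noise ξ : ℝ} (hξ : 0 ≤ ξ) {x : ℕ → Plane}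
    (hx : ∀ j, x j ≠ 0) (i : ℕ) :
    P {ω | (x, (s.tx₀ ω, fun j => s.mark j ω)) ∈ discoverySet M α noise ξ i}
      = ENNReal.ofReal ((1 - ρ) * ρ) * (expNeg (ENNReal.ofReal (ξ * noise / ‖x i‖ ^ (-α))) *
        expNeg (∑' j, if j = i then 0 else interferenceExponent (ρ / M)
          (ξ / ‖x i‖ ^ (-α) * ‖x j‖ ^ (-α)))) := by
  have hM1 : (1 : ℝ) ≤ M := by exact_mod_cast hM
  have hp : ρ / M < 1 := (div_le_self hρ0 hM1).trans_lt hρ1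
  have hc : ∀ j, 0 < ‖x j‖ ^ (-α) := fun j => Real.rpow_pos_of_pos (norm_pos_iff.2 (hx j)) _
  set p := expNeg (ENNReal.ofReal (ξ * noise / ‖x i‖ ^ (-α))) *
        expNeg (∑' j, if j = i then 0 else interferenceExponent (ρ / M)
          (ξ / ‖x i‖ ^ (-α) * ‖x j‖ ^ (-α)))
  let S : Set (ℕ → (Bool × Fin M) × (ℝ × ℝ)) :=
    (fun z => (x, (false, z))) ⁻¹' discoverySet M α noise ξ i
  have hS : MeasurableSet S :=
    (show Measurable fun z => (x, (false, z)) by fun_prop) (measurableSet_discoverySet M α noise ξ i)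
  have hmark : Measurable fun ω j => s.mark j ω := measurable_pi_lambda _ s.measurable_mark
  have htx : P (s.tx₀ ⁻¹' {false}) = ENNReal.ofReal (1 - ρ) := by
    have h1 : s.tx₀ ⁻¹' {false} = {ω | s.tx₀ ω = true}ᶜ := by
      ext ω; simp
    have h2 : MeasurableSet {ω | s.tx₀ ω = true} := s.measurable_tx₀ (measurableSet_singleton true)
    rw [h1, prob_compl_eq_one_sub h2, s.law_tx₀, ENNReal.ofReal_sub _ hρ0, ENNReal.ofReal_one]
  -- The block of node `i` is random; splitting by its value makes the interference that of a fixed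
  -- block. The `M` disjoint pieces have equal probability, and `M * (ρ / M) = ρ`.
  have hunion : (fun ω j => s.mark j ω) ⁻¹' S = ⋃ m : Fin M,
      {ω | (s.tx i ω = true ∧ s.rb i ω = m) ∧ ENNReal.ofReal ξ *
        ((∑' j, if j = i then 0 else received m (‖x j‖ ^ (-α)) (s.mark j ω)) +
          ENNReal.ofReal noise) < ENNReal.ofReal (‖x i‖ ^ (-α) * s.h i ω)} := by
    ext ω
    simp only [Set.mem_preimage, Set.mem_iUnion, Set.mem_ofPred_eq, S, discoverySet]
    constructor
    · rintro ⟨-, h1, h2⟩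
      exact ⟨s.rb i ω, ⟨h1, rfl⟩, h2⟩
    · rintro ⟨m, ⟨h1, rfl⟩, h2⟩
      exact ⟨trivial, h1, h2⟩
  have hPS : P ((fun ω j => s.mark j ω) ⁻¹' S) = ENNReal.ofReal ρ * p := by
    rw [hunion, measure_iUnion]
    · rw [tsum_congr fun m => s.measure_decoded hρ0 hp hξ hc i m, tsum_fintype, Finset.sum_const,
        Finset.card_univ, Fintype.card_fin, nsmul_eq_mul, ← mul_assoc, ← ENNReal.ofReal_natCast,
        ← ENNReal.ofReal_mul (by positivity)]
      congr 2
      field_simp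
    · intro m m' hmm
      refine Set.disjoint_left.2 fun ω h h' => hmm ?_
      exact h.1.2.symm.trans h'.1.2
    · intro m
      refine MeasurableSet.inter ((s.measurable_tx i (measurableSet_singleton true)).inter
        (s.measurable_rb i (measurableSet_singleton m))) ?_
      refine measurableSet_lt (Measurable.const_mul (Measurable.add_const
        (Measurable.tsum fun j => ?_) _) _) (((s.measurable_h i).const_mul _).ennreal_ofReal)
      split_ifs
      · exact measurable_const
      · exact (measurable_received _ _).comp (s.measurable_mark j)
  have hset : {ω | (x, (s.tx₀ ω, fun j => s.mark j ω)) ∈ discoverySet M α noise ξ i}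
      = s.tx₀ ⁻¹' {false} ∩ (fun ω j => s.mark j ω) ⁻¹' S := by
    ext ω
    simp [S, discoverySet]
  have hind : IndepFun s.tx₀ (fun ω j => s.mark j ω) P := s.indep_typical
  rw [hset, hind.measure_inter_preimage_eq_mul {false} S (measurableSet_singleton _) hS,
    htx, hPS, ← mul_assoc, ← ENNReal.ofReal_mul (by linarith)]

/-- The average number of discovered nodes as a functional of the locations. -/
lemma meanDiscovered_eq [IsProbabilityMeasure P] (s : HelloSlot P lam M ρ rayleighGain)
    (hM : 0 < M) (hρ0 : 0 ≤ ρ) (hρ1 : ρ < 1) {α noise ξ : ℝ} (hξ : 0 < ξ) :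
    s.meanDiscovered α noise ξ = ENNReal.ofReal ((1 - ρ) * ρ) * ∫⁻ ω, ∑' i,
      expNeg (ENNReal.ofReal (ξ * noise / ‖s.X i ω‖ ^ (-α))) *
        expNeg (∑' j, if j = i then 0 else interferenceExponent (ρ / M)
          (ξ / ‖s.X i ω‖ ^ (-α) * ‖s.X j ω‖ ^ (-α))) ∂P := by
  have hX : Measurable fun ω i => s.X i ω := measurable_pi_lambda _ s.poisson.measurable
  have hmk : Measurable fun ω => (s.tx₀ ω, fun j => s.mark j ω) :=
    s.measurable_tx₀.prodMk (measurable_pi_lambda _ s.measurable_mark)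
  -- Almost surely no node sits at the origin, so all path gains are positive.
  have hne : ∀ᵐ ω ∂P, ∀ j, s.X j ω ≠ 0 :=
    s.poisson.ae_notMem (measurableSet_singleton 0) (by simp)
  have hmeas : ∀ i, MeasurableSet {ω | ((fun j => s.X j ω), (s.tx₀ ω, fun j => s.mark j ω)) ∈
      discoverySet M α noise ξ i} := fun i =>
    (hX.prodMk hmk) (measurableSet_discoverySet M α noise ξ i)
  have hcount : ∀ ω, (s.discovered α noise ξ ω : ℝ≥0∞) = ∑' i, Set.indicator
      {ω | ((fun j => s.X j ω), (s.tx₀ ω, fun j => s.mark j ω)) ∈ discoverySet M α noise ξ i}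
      1 ω := by
    intro ω
    rw [discovered, ← ENNReal.tsum_set_one, tsum_subtype _ fun _ => (1 : ℝ≥0∞)]
    refine tsum_congr fun i => ?_
    have key : ∀ (A : Set Ω) (B : Set ℕ), (i ∈ B ↔ ω ∈ A) →
        B.indicator (fun _ => (1 : ℝ≥0∞)) i = A.indicator 1 ω := by
      intro A B h
      by_cases hB : i ∈ B
      · simp [hB, h.1 hB]
      · simp [hB, mt h.2 hB]
    exact key _ _ (s.mem_discoverySet_iff hξ i ω).symm
  have hK : ∀ i, Measurable fun ω => expNeg (ENNReal.ofReal (ξ * noise / ‖s.X i ω‖ ^ (-α))) *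
        expNeg (∑' j, if j = i then 0 else interferenceExponent (ρ / M)
          (ξ / ‖s.X i ω‖ ^ (-α) * ‖s.X j ω‖ ^ (-α))) := by
    intro i
    have hXm := s.poisson.measurable
    refine Measurable.mul (by fun_prop) (measurable_expNeg.comp (Measurable.tsum fun j => ?_))
    unfold interferenceExponent
    split_ifs <;> fun_prop
  rw [meanDiscovered, lintegral_congr hcount, lintegral_tsum fun i =>
    (measurable_one.indicator (hmeas i)).aemeasurable, lintegral_tsum fun i => (hK i).aemeasurable,
    ← ENNReal.tsum_mul_left]
  refine tsum_congr fun i => ?_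
  have hind : IndepFun (fun ω j => s.X j ω) (fun ω => (s.tx₀ ω, fun j => s.mark j ω)) P :=
    s.indep_location
  rw [lintegral_indicator_one (hmeas i), hind.measure_mem_prod hX hmk
    (measurableSet_discoverySet M α noise ξ i), ← lintegral_const_mul _ (hK i)]
  refine lintegral_congr_ae ?_
  filter_upwards [hne] with ω hω
  exact s.measure_discoverySet hM hρ0 hρ1 hξ.le hω i

end HelloSlot

/-! ### Bounds on the integral of `exp (-(b t² + a t))` -/

section GaussianExponential

variable {a b : ℝ}

lemma mul_sq_mul_exp_le_one (b t : ℝ) : b * t ^ 2 * Real.exp (-(b * t ^ 2)) ≤ 1 := by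
  have h := Real.add_one_le_exp (b * t ^ 2)
  rw [Real.exp_neg, ← div_eq_mul_inv, div_le_one (Real.exp_pos _)]
  linarith

lemma integrableOn_exp_neg_mul_Ioi (ha : 0 < a) :
    IntegrableOn (fun t => Real.exp (-(a * t))) (Set.Ioi 0) := by
  simpa using exp_neg_integrableOn_Ioi 0 ha

lemma integral_exp_neg_mul_Ioi (ha : 0 < a) :
    ∫ t in Set.Ioi 0, Real.exp (-(a * t)) = 1 / a := by
  have := integral_exp_mul_Ioi (a := -a) (by linarith) 0
  simpa using this

lemma exp_quadratic_le (hb : 0 ≤ b) (t : ℝ) :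
    Real.exp (-(b * t ^ 2 + a * t)) ≤ Real.exp (-(a * t)) :=
  Real.exp_le_exp.2 (by nlinarith [mul_nonneg hb (sq_nonneg t)])

lemma integrableOn_exp_quadratic (ha : 0 < a) (hb : 0 ≤ b) :
    IntegrableOn (fun t => Real.exp (-(b * t ^ 2 + a * t))) (Set.Ioi 0) := by
  refine Integrable.mono' (integrableOn_exp_neg_mul_Ioi ha)
    (by fun_prop) (Filter.Eventually.of_forall fun t => ?_)
  rw [Real.norm_of_nonneg (Real.exp_nonneg _)]
  exact exp_quadratic_le hb t

lemma integrableOn_sq_mul_exp_quadratic (ha : 0 < a) (hb : 0 ≤ b) :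
    IntegrableOn (fun t => b * t ^ 2 * Real.exp (-(b * t ^ 2 + a * t))) (Set.Ioi 0) := by
  refine Integrable.mono' (integrableOn_exp_neg_mul_Ioi ha)
    (by fun_prop) (Filter.Eventually.of_forall fun t => ?_)
  rw [Real.norm_of_nonneg (by positivity), neg_add, Real.exp_add, ← mul_assoc]
  exact mul_le_of_le_one_left (Real.exp_nonneg _) (mul_sq_mul_exp_le_one b t)

lemma setIntegral_Ioi_pos {f : ℝ → ℝ} (hf : IntegrableOn f (Set.Ioi 0))
    (hpos : ∀ t, 0 < t → 0 < f t) : 0 < ∫ t in Set.Ioi 0, f t := by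
  rw [setIntegral_pos_iff_support_of_nonneg_ae _ hf]
  · have : Set.Ioi (0 : ℝ) ⊆ Function.support f ∩ Set.Ioi 0 :=
      fun t ht => ⟨(hpos t ht).ne', ht⟩
    exact lt_of_lt_of_le (by simp) (measure_mono this)
  · exact (ae_restrict_iff' measurableSet_Ioi).2 (Filter.Eventually.of_forall fun t ht =>
      (hpos t ht).le)

lemma integral_exp_quadratic_lt (ha : 0 < a) (hb : 0 < b) :
    ∫ t in Set.Ioi 0, Real.exp (-(b * t ^ 2 + a * t)) < 1 / a := by
  have h := setIntegral_Ioi_pos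
    ((integrableOn_exp_neg_mul_Ioi ha).sub (integrableOn_exp_quadratic ha hb.le)) fun t ht =>
      sub_pos.2 (Real.exp_lt_exp.2 (show -(b * t ^ 2 + a * t) < -(a * t) by
        have : 0 < b * t ^ 2 := by positivity
        linarith))
  simp only [Pi.sub_apply] at h
  rw [integral_sub (integrableOn_exp_neg_mul_Ioi ha) (integrableOn_exp_quadratic ha hb.le),
    integral_exp_neg_mul_Ioi ha] at h
  linarith

/-- The factor `exp (-(b t²))` keeps the linear factor bounded, and `exp (-(a t))` forces the decay.
This is the boundary term at infinity in `lt_integral_exp_quadratic`. -/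
lemma tendsto_linear_mul_exp_quadratic (ha : 0 < a) (hb : 0 ≤ b) :
    Filter.Tendsto (fun t => (2 * b * t - a) * Real.exp (-(b * t ^ 2 + a * t))) Filter.atTop
      (nhds 0) := by
  have hlim : Filter.Tendsto (fun t => (a + 2 * (b + 1)) * Real.exp (-(a * t))) Filter.atTop
      (nhds 0) := by
    have := (Real.tendsto_exp_neg_atTop_nhds_zero.comp
      (Filter.tendsto_id.const_mul_atTop ha)).const_mul (a + 2 * (b + 1))
    simpa using this
  refine squeeze_zero_norm' ?_ hlim
  filter_upwards [Filter.eventually_ge_atTop 0] with t ht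
  have h1 := mul_sq_mul_exp_le_one b t
  have h2 : Real.exp (-(b * t ^ 2)) ≤ 1 := Real.exp_le_one_iff.2 (by
    have : 0 ≤ b * t ^ 2 := by positivity
    linarith)
  have h0 := Real.exp_nonneg (-(b * t ^ 2))
  have h3 : b * t * Real.exp (-(b * t ^ 2)) ≤ b + 1 := by
    have : b * t ≤ b + b * t ^ 2 := by nlinarith [sq_nonneg (t - 1), mul_nonneg hb (sq_nonneg t)]
    nlinarith
  have h4 : |2 * b * t - a| ≤ 2 * (b * t) + a := by
    have : 0 ≤ b * t := by positivity
    rw [abs_le]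
    constructor <;> linarith
  rw [norm_mul, Real.norm_eq_abs, Real.norm_of_nonneg (Real.exp_nonneg _), neg_add, Real.exp_add,
    ← mul_assoc]
  refine mul_le_mul_of_nonneg_right ?_ (Real.exp_nonneg _)
  calc |2 * b * t - a| * Real.exp (-(b * t ^ 2))
      ≤ (2 * (b * t) + a) * Real.exp (-(b * t ^ 2)) := mul_le_mul_of_nonneg_right h4 h0
    _ ≤ _ := by nlinarith

/-- A lower bound of Mills ratio type. -/
lemma lt_integral_exp_quadratic (ha : 0 < a) (hb : 0 < b) :
    a / (a ^ 2 + 2 * b) < ∫ t in Set.Ioi 0, Real.exp (-(b * t ^ 2 + a * t)) := by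
  set f : ℝ → ℝ := fun t => Real.exp (-(b * t ^ 2 + a * t)) with hf
  have hfi := integrableOn_exp_quadratic ha hb.le
  have hsq := (integrableOn_sq_mul_exp_quadratic ha hb.le).const_mul (4 * b)
  have hc : 0 < a ^ 2 + 2 * b := by positivity
  -- The factor `2 b t - a` is chosen because `(2 b t - a)(2 b t + a)` has no linear term.
  -- Integrating gives `a = (a² + 2 b) ∫ f - 4 b² ∫ t² f`, and dropping the last integral gives the
  -- strict bound.
  have hderiv : ∀ t, HasDerivAt (fun t => (2 * b * t - a) * f t)
      ((a ^ 2 + 2 * b) * f t - 4 * b * (b * t ^ 2 * f t)) t := by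
    intro t
    have h1 : HasDerivAt (fun t : ℝ => 2 * b * t - a) (2 * b) t := by
      simpa using ((hasDerivAt_id t).const_mul (2 * b)).sub_const a
    have h2 : HasDerivAt (fun t : ℝ => -(b * t ^ 2 + a * t)) (-(2 * b * t + a)) t := by
      have := (((hasDerivAt_pow 2 t).const_mul b).add ((hasDerivAt_id t).const_mul a)).neg
      exact this.congr_deriv (by norm_num; ring)
    exact (h1.mul h2.exp).congr_deriv (by simp only [hf]; ring)
  have hint := integral_Ioi_of_hasDerivAt_of_tendsto
    (hderiv 0).continuousAt.continuousWithinAt (fun t _ => hderiv t)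
    ((hfi.const_mul (a ^ 2 + 2 * b)).sub hsq) (tendsto_linear_mul_exp_quadratic ha hb.le)
  have hpos := setIntegral_Ioi_pos hsq fun t ht => by positivity
  rw [integral_sub (hfi.const_mul _) hsq, integral_const_mul] at hint
  have h0 : f 0 = 1 := by simp [hf]
  rw [h0] at hint
  rw [div_lt_iff₀ hc]
  linarith

lemma setLIntegral_expNeg_quadratic (ha : 0 < a) (hb : 0 ≤ b) :
    ∫⁻ t in Set.Ioi 0, expNeg (ENNReal.ofReal (b * t ^ 2 + a * t))
      = ENNReal.ofReal (∫ t in Set.Ioi 0, Real.exp (-(b * t ^ 2 + a * t))) := by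
  rw [ofReal_integral_eq_lintegral_ofReal (integrableOn_exp_quadratic ha hb)
    (Filter.Eventually.of_forall fun t => Real.exp_nonneg _)]
  refine setLIntegral_congr_fun measurableSet_Ioi fun t ht => ?_
  have : 0 < t := ht
  exact expNeg_ofReal (by positivity)

end GaussianExponential

/-! ### Riemann sums of antitone functions -/

section RiemannSums

variable {f : ℝ → ℝ≥0∞} {δ : ℝ}

lemma setLIntegral_Ioi_eq_tsum (hδ : 0 < δ) (f : ℝ → ℝ≥0∞) :
    ∫⁻ t in Set.Ioi 0, f t = ∑' k : ℕ, ∫⁻ t in Set.Ico (k * δ) ((k + 1) * δ), f t := by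
  have hmem : ∀ (k : ℕ) (t : ℝ), t ∈ Set.Ico (k * δ) ((k + 1) * δ) ↔ 0 ≤ t ∧ ⌊t / δ⌋₊ = k := by
    intro k t
    rw [Set.mem_Ico, ← le_div_iff₀ hδ, ← div_lt_iff₀ hδ]
    constructor
    · rintro ⟨h1, h2⟩
      have h0 : 0 ≤ t / δ := (Nat.cast_nonneg k).trans h1
      exact ⟨by simpa [div_mul_cancel₀ _ hδ.ne'] using mul_nonneg h0 hδ.le,
        (Nat.floor_eq_iff h0).2 ⟨h1, h2⟩⟩
    · rintro ⟨h1, h2⟩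
      exact (Nat.floor_eq_iff (div_nonneg h1 hδ.le)).1 h2
  have hU : Set.Ici (0 : ℝ) = ⋃ k : ℕ, Set.Ico (k * δ) ((k + 1) * δ) := by
    ext t
    simp only [Set.mem_iUnion, hmem]
    simp
  rw [setLIntegral_congr Ioi_ae_eq_Ici, hU, lintegral_iUnion (fun k => measurableSet_Ico)]
  intro k k' hk
  refine Set.disjoint_left.2 fun t h h' => hk ?_
  rw [← ((hmem k t).1 h).2, ((hmem k' t).1 h').2]

lemma setLIntegral_Ioi_le_tsum (hδ : 0 < δ) (hf : AntitoneOn f (Set.Ici 0)) :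
    ∫⁻ t in Set.Ioi 0, f t ≤ ∑' k : ℕ, ENNReal.ofReal δ * f (k * δ) := by
  rw [setLIntegral_Ioi_eq_tsum hδ]
  refine ENNReal.tsum_le_tsum fun k => ?_
  have h0 : (0 : ℝ) ≤ k * δ := by positivity
  calc ∫⁻ t in Set.Ico (k * δ) ((k + 1) * δ), f t
      ≤ ∫⁻ _ in Set.Ico (k * δ) ((k + 1) * δ), f (k * δ) :=
        setLIntegral_mono' measurableSet_Ico fun t ht => hf h0 (h0.trans ht.1) ht.1
    _ = _ := by
        rw [setLIntegral_const, Real.volume_Ico, mul_comm]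
        ring_nf

lemma tsum_le_setLIntegral_Ioi (hδ : 0 < δ) (hf : AntitoneOn f (Set.Ici 0)) :
    ∑' k : ℕ, ENNReal.ofReal δ * f ((k + 1) * δ) ≤ ∫⁻ t in Set.Ioi 0, f t := by
  rw [setLIntegral_Ioi_eq_tsum hδ]
  refine ENNReal.tsum_le_tsum fun k => ?_
  have h0 : (0 : ℝ) ≤ k * δ := by positivity
  have h1 : (0 : ℝ) ≤ (k + 1) * δ := by positivity
  calc _ = ∫⁻ _ in Set.Ico (k * δ) ((k + 1) * δ), f ((k + 1) * δ) := by
        rw [setLIntegral_const, Real.volume_Ico, mul_comm]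
        ring_nf
    _ ≤ _ := setLIntegral_mono' measurableSet_Ico fun t ht => hf (h0.trans ht.1) h1 ht.2.le

/-- The left and right Riemann sums differ by the first cell only, which is the source of every
discretisation error below. -/
lemma tsum_cell_eq_add (δ : ℝ) (f : ℝ → ℝ≥0∞) :
    ∑' k : ℕ, ENNReal.ofReal δ * f (k * δ)
      = ENNReal.ofReal δ * f 0 + ∑' k : ℕ, ENNReal.ofReal δ * f ((k + 1) * δ) := by
  rw [tsum_eq_zero_add' ENNReal.summable]
  simp

end RiemannSums

/-! ### The interference ratio and its Riemann sums -/

/-- The relative strength `ξ r² / (t² + ξ r²)` of an interferer at squared distance `t` for a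
target at squared distance `r`. -/
noncomputable def interferenceRatio (ξ r t : ℝ) : ℝ := ξ * r ^ 2 / (t ^ 2 + ξ * r ^ 2)

section InterferenceRatio

variable {ξ r r' t t' : ℝ}

lemma interferenceRatio_nonneg (hξ : 0 ≤ ξ) (r t : ℝ) : 0 ≤ interferenceRatio ξ r t := by
  unfold interferenceRatio
  positivity

lemma interferenceRatio_le_one (hξ : 0 ≤ ξ) (r t : ℝ) : interferenceRatio ξ r t ≤ 1 := by
  unfold interferenceRatio
  exact div_le_one_of_le₀ (by nlinarith [sq_nonneg t]) (by positivity)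

lemma interferenceRatio_anti_right (hξ : 0 ≤ ξ) (r : ℝ) :
    AntitoneOn (interferenceRatio ξ r) (Set.Ici 0) := by
  intro t ht t' _ h
  have ht0 : 0 ≤ t := ht
  have h0 : 0 ≤ ξ * r ^ 2 := by positivity
  -- If `ξ r² = 0` the ratio is identically `0`, including the quotient `0 / 0` at `t = 0`.
  rcases h0.eq_or_lt with h0 | h0
  · simp [interferenceRatio, ← h0]
  · unfold interferenceRatio
    gcongr

lemma interferenceRatio_mono_left (hξ : 0 < ξ) (hr : 0 ≤ r) (h : r ≤ r') (t : ℝ) :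
    interferenceRatio ξ r t ≤ interferenceRatio ξ r' t := by
  rcases hr.eq_or_lt with rfl | hr
  · simpa [interferenceRatio] using interferenceRatio_nonneg hξ.le r' t
  · have h' : 0 < r' := hr.trans_le h
    unfold interferenceRatio
    rw [div_le_div_iff₀ (by positivity) (by positivity)]
    have : ξ * r ^ 2 ≤ ξ * r' ^ 2 := by gcongr
    nlinarith [mul_le_mul_of_nonneg_right this (sq_nonneg t)]

/-- The substitution `t = √ξ r u` reduces this to the arctangent integral `∫ 1 / (1 + u²) = π / 2`.
-/
lemma setLIntegral_interferenceRatio {p : ℝ} (hp : 0 ≤ p) (hξ : 0 < ξ) (hr : 0 ≤ r) :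
    ∫⁻ t in Set.Ioi 0, ENNReal.ofReal (p * interferenceRatio ξ r t)
      = ENNReal.ofReal (p * (Real.sqrt ξ * r * (Real.pi / 2))) := by
  rcases hr.eq_or_lt with rfl | hr
  · simp [interferenceRatio]
  have hs : 0 < Real.sqrt ξ * r := by positivity
  have hsq : (Real.sqrt ξ * r) ^ 2 = ξ * r ^ 2 := by rw [mul_pow, Real.sq_sqrt hξ.le]
  have heq : ∀ t, interferenceRatio ξ r t = (1 + ((Real.sqrt ξ * r)⁻¹ * t) ^ 2)⁻¹ := by
    intro t
    rw [interferenceRatio, ← hsq]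
    field_simp
    ring
  have hint : IntegrableOn (fun t => (1 + ((Real.sqrt ξ * r)⁻¹ * t) ^ 2)⁻¹) (Set.Ioi 0) :=
    (integrable_inv_one_add_sq.comp_mul_left' (inv_pos.2 hs).ne').integrableOn
  simp_rw [heq]
  rw [← ofReal_integral_eq_lintegral_ofReal (hint.const_mul p)
    (Filter.Eventually.of_forall fun t => by positivity), integral_const_mul,
    integral_comp_mul_left_Ioi (fun t => (1 + t ^ 2)⁻¹) 0 (inv_pos.2 hs), mul_zero,
    integral_Ioi_inv_one_add_sq]
  simp

end InterferenceRatio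

section RiemannBounds

variable {p ξ r δ μ : ℝ}

lemma antitoneOn_ofReal_interferenceRatio (hp : 0 ≤ p) (hξ : 0 < ξ) (r : ℝ) :
    AntitoneOn (fun t => ENNReal.ofReal (p * interferenceRatio ξ r t)) (Set.Ici 0) :=
  fun _ ht _ ht' h => ENNReal.ofReal_le_ofReal
    (mul_le_mul_of_nonneg_left (interferenceRatio_anti_right hξ.le r ht ht' h) hp)

/-- The right-endpoint sum falls short of the integral by at most the first cell, of size `δ p`;
after scaling by `μ` this costs the factor `exp (μ δ p)`. -/
lemma expNeg_upper_cells_le (hp : 0 ≤ p) (hξ : 0 < ξ) (hr : 0 ≤ r) (hδ : 0 < δ) (hμ : 0 ≤ μ) :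
    expNeg (ENNReal.ofReal (μ * δ) *
        ∑' k : ℕ, ENNReal.ofReal (p * interferenceRatio ξ r ((k + 1) * δ)))
      ≤ ENNReal.ofReal (Real.exp (μ * δ * p)) *
        expNeg (ENNReal.ofReal (μ * p * (Real.sqrt ξ * (Real.pi / 2)) * r)) := by
  refine expNeg_le_of_le_add (by positivity) ?_
  have h := setLIntegral_Ioi_le_tsum hδ (antitoneOn_ofReal_interferenceRatio hp hξ r)
  rw [tsum_cell_eq_add δ fun t => ENNReal.ofReal (p * interferenceRatio ξ r t),
    setLIntegral_interferenceRatio hp hξ hr, ENNReal.tsum_mul_left] at h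
  have h0 : ENNReal.ofReal (p * interferenceRatio ξ r 0) ≤ ENNReal.ofReal p :=
    ENNReal.ofReal_le_ofReal (mul_le_of_le_one_right hp (interferenceRatio_le_one hξ.le r 0))
  calc ENNReal.ofReal (μ * p * (Real.sqrt ξ * (Real.pi / 2)) * r)
      = ENNReal.ofReal μ * ENNReal.ofReal (p * (Real.sqrt ξ * r * (Real.pi / 2))) := by
        rw [← ENNReal.ofReal_mul hμ]
        ring_nf
    _ ≤ ENNReal.ofReal μ * (ENNReal.ofReal δ * ENNReal.ofReal p + ENNReal.ofReal δ *
          ∑' k : ℕ, ENNReal.ofReal (p * interferenceRatio ξ r ((k + 1) * δ))) := by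
        refine mul_le_mul_right (h.trans ?_) _
        gcongr
    _ = _ := by
        rw [mul_add, ENNReal.ofReal_mul (by positivity), ENNReal.ofReal_mul hμ]
        ring

/-- Here the left-endpoint sum exceeds the integral by at most the same first cell. -/
lemma le_expNeg_lower_cells (hp : 0 ≤ p) (hξ : 0 < ξ) (hr : 0 ≤ r) (hδ : 0 < δ) (hμ : 0 ≤ μ) :
    expNeg (ENNReal.ofReal (μ * p * (Real.sqrt ξ * (Real.pi / 2)) * r))
      ≤ ENNReal.ofReal (Real.exp (μ * δ * p)) * expNeg (ENNReal.ofReal (μ * δ) *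
        ∑' k : ℕ, ENNReal.ofReal (p * interferenceRatio ξ r (k * δ))) := by
  refine expNeg_le_of_le_add (by positivity) ?_
  have h := tsum_le_setLIntegral_Ioi hδ (antitoneOn_ofReal_interferenceRatio hp hξ r)
  rw [setLIntegral_interferenceRatio hp hξ hr] at h
  have h0 : ENNReal.ofReal (p * interferenceRatio ξ r 0) ≤ ENNReal.ofReal p :=
    ENNReal.ofReal_le_ofReal (mul_le_of_le_one_right hp (interferenceRatio_le_one hξ.le r 0))
  calc ENNReal.ofReal (μ * δ) * ∑' k : ℕ, ENNReal.ofReal (p * interferenceRatio ξ r (k * δ))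
      = ENNReal.ofReal μ *
          ∑' k : ℕ, ENNReal.ofReal δ * ENNReal.ofReal (p * interferenceRatio ξ r (k * δ)) := by
        rw [ENNReal.tsum_mul_left, ENNReal.ofReal_mul hμ, mul_assoc]
    _ ≤ ENNReal.ofReal μ * (ENNReal.ofReal δ * ENNReal.ofReal p +
          ENNReal.ofReal (p * (Real.sqrt ξ * r * (Real.pi / 2)))) := by
        rw [tsum_cell_eq_add δ fun t => ENNReal.ofReal (p * interferenceRatio ξ r t)]
        refine mul_le_mul_right (add_le_add ?_ h) _
        gcongr
    _ = _ := by
        rw [mul_add, ENNReal.ofReal_mul (p := μ * δ) (by positivity), ENNReal.ofReal_mul hμ,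
          ← ENNReal.ofReal_mul hμ, mul_assoc]
        ring_nf

end RiemannBounds

/-! ### Palm formula for functionals of the cells, and its planar form -/

section Cells

variable {Ω E : Type*} [MeasurableSpace Ω] [MeasurableSpace E] {P : Measure Ω} {Λ : Measure E}
  {X : ℕ → Ω → E}

/-- Splitting by the cell `k` of the target freezes the weight and the exponents, so the one-cell
formula applies to each `k`. -/
lemma IsPoissonProcess.lintegral_cells [IsProbabilityMeasure P] (h : IsPoissonProcess P Λ X)
    {q : E → ℕ} (hq : Measurable q) {r : ℝ≥0} (hr : ∀ t, Λ (q ⁻¹' {t}) = r) (a : ℕ → ℝ≥0∞)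
    (c : ℕ → ℕ → ℝ≥0∞) :
    ∫⁻ ω, ∑' i, a (q (X i ω)) *
        expNeg (∑' j, if j = i then 0 else c (q (X i ω)) (q (X j ω))) ∂P
      = ∑' k, a k * (r * expNeg (r * ∑' t, (1 - expNeg (c k t)))) := by
  have hqX : ∀ i, Measurable fun ω => q (X i ω) := fun i => hq.comp (h.measurable i)
  have hsplit : ∀ ω, ∑' i, a (q (X i ω)) *
        expNeg (∑' j, if j = i then 0 else c (q (X i ω)) (q (X j ω)))
      = ∑' k, a k * ∑' i, if q (X i ω) = k then
          expNeg (∑' j, if j = i then 0 else c k (q (X j ω))) else 0 := by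
    intro ω
    simp_rw [← ENNReal.tsum_mul_left]
    rw [ENNReal.tsum_comm]
    refine tsum_congr fun i => ?_
    refine Eq.symm ((tsum_eq_single (q (X i ω)) fun k hk => ?_).trans ?_)
    · rw [if_neg hk.symm, mul_zero]
    · rw [if_pos rfl]
  have hm : ∀ k, Measurable fun ω => ∑' i, if q (X i ω) = k then
      expNeg (∑' j, if j = i then 0 else c k (q (X j ω))) else 0 := by
    intro k
    refine Measurable.tsum fun i => Measurable.ite (hqX i (measurableSet_singleton k))
      (measurable_expNeg.comp (Measurable.tsum fun j => ?_)) measurable_const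
    split_ifs
    · exact measurable_const
    · exact (Measurable.of_discrete (f := c k)).comp (hqX j)
  rw [lintegral_congr hsplit, lintegral_tsum fun k => ((hm k).const_mul _).aemeasurable]
  refine tsum_congr fun k => ?_
  rw [lintegral_const_mul _ (hm k), h.lintegral_cell hq hr]

end Cells

section Planar

/-- The intensity of a planar annulus that is bounded by squared radii `k δ` and `(k + 1) δ`. -/
lemma volume_annulus {lam δ : ℝ} (hlam : 0 ≤ lam) (hδ : 0 < δ) (k : ℕ) :
    (ENNReal.ofReal lam • (volume : Measure Plane)) ((fun x => ⌊‖x‖ ^ 2 / δ⌋₊) ⁻¹' {k})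
      = ((lam * Real.pi * δ).toNNReal : ℝ≥0∞) := by
  have hset : (fun x : Plane => ⌊‖x‖ ^ 2 / δ⌋₊) ⁻¹' {k} =
      Metric.ball 0 (Real.sqrt ((k + 1) * δ)) \ Metric.ball 0 (Real.sqrt (k * δ)) := by
    ext x
    rw [Set.mem_preimage, Set.mem_singleton_iff, Nat.floor_eq_iff (by positivity),
      le_div_iff₀ hδ, div_lt_iff₀ hδ, Set.mem_sdiff, mem_ball_zero_iff, mem_ball_zero_iff, not_lt,
      Real.lt_sqrt (norm_nonneg x), Real.sqrt_le_left (norm_nonneg x)]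
    exact and_comm
  have hsub : Metric.ball (0 : Plane) (Real.sqrt (k * δ)) ⊆
      Metric.ball 0 (Real.sqrt ((k + 1) * δ)) :=
    Metric.ball_subset_ball (Real.sqrt_le_sqrt (by nlinarith))
  rw [hset, Measure.smul_apply, smul_eq_mul, measure_sdiff hsub
    measurableSet_ball.nullMeasurableSet measure_ball_lt_top.ne,
    EuclideanSpace.volume_ball_fin_two, EuclideanSpace.volume_ball_fin_two,
    ← ENNReal.ofReal_pow (Real.sqrt_nonneg _), ← ENNReal.ofReal_pow (Real.sqrt_nonneg _),
    Real.sq_sqrt (by positivity), Real.sq_sqrt (by positivity)]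
  rw [← ENNReal.ofReal_mul (by positivity), ← ENNReal.ofReal_mul (by positivity),
    ← ENNReal.ofReal_sub _ (by positivity), ← ENNReal.ofReal_mul hlam]
  change _ = ENNReal.ofReal _
  ring_nf

end Planar

/-! ### Rounding squared distances and letting the mesh tend to zero -/

/-- The interference exponent in terms of the squared distances `r` of the target and `t` of the
interferer. -/
noncomputable def radialExponent (p ξ r t : ℝ) : ℝ≥0∞ :=
  ENNReal.ofReal (-Real.log (1 - p * interferenceRatio ξ r t))

section RadialExponent

variable {p ξ r r' t t' : ℝ}

lemma one_sub_mul_interferenceRatio_pos (hp0 : 0 ≤ p) (hp1 : p < 1) (hξ : 0 ≤ ξ) (r t : ℝ) :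
    0 < 1 - p * interferenceRatio ξ r t := by
  nlinarith [interferenceRatio_le_one hξ r t]

/-- The Palm formula sees an exponent only through this quantity, so the logarithm disappears and
Riemann sums of `interferenceRatio` remain. -/
lemma one_sub_expNeg_radialExponent (hp0 : 0 ≤ p) (hp1 : p < 1) (hξ : 0 ≤ ξ) (r t : ℝ) :
    1 - expNeg (radialExponent p ξ r t) = ENNReal.ofReal (p * interferenceRatio ξ r t) := by
  have h0 := mul_nonneg hp0 (interferenceRatio_nonneg hξ r t)
  have h1 := one_sub_mul_interferenceRatio_pos hp0 hp1 hξ r t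
  rw [radialExponent, expNeg_neg_log h1 (by linarith), ← ENNReal.ofReal_one,
    ← ENNReal.ofReal_sub _ h1.le]
  ring_nf

/-- A farther target or a nearer interferer increases the exponent; this is what makes rounding
one-sided. -/
lemma radialExponent_le (hp0 : 0 ≤ p) (hp1 : p < 1) (hξ : 0 < ξ) (hr : 0 ≤ r) (hrr : r ≤ r')
    (ht' : 0 ≤ t') (htt : t' ≤ t) : radialExponent p ξ r t ≤ radialExponent p ξ r' t' := by
  refine ENNReal.ofReal_le_ofReal (neg_le_neg (Real.log_le_log
    (one_sub_mul_interferenceRatio_pos hp0 hp1 hξ.le r' t') ?_))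
  refine sub_le_sub_left (mul_le_mul_of_nonneg_left ?_ hp0) _
  exact (interferenceRatio_mono_left hξ hr hrr t).trans
    (interferenceRatio_anti_right hξ.le r' ht' (ht'.trans htt) htt)

end RadialExponent

section Planar

variable {Ω : Type*} [MeasurableSpace Ω] {P : Measure Ω} [IsProbabilityMeasure P]
  {lam p ξ b δ : ℝ} {X : ℕ → Ω → Plane}

lemma IsPoissonProcess.lintegral_annuli
    (h : IsPoissonProcess P (ENNReal.ofReal lam • (volume : Measure Plane)) X) (hlam : 0 ≤ lam)
    (hδ : 0 < δ) (a : ℕ → ℝ≥0∞) (c : ℕ → ℕ → ℝ≥0∞) :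
    ∫⁻ ω, ∑' i, a ⌊‖X i ω‖ ^ 2 / δ⌋₊ * expNeg (∑' j, if j = i then 0 else
        c ⌊‖X i ω‖ ^ 2 / δ⌋₊ ⌊‖X j ω‖ ^ 2 / δ⌋₊) ∂P
      = ∑' k, a k * (ENNReal.ofReal (lam * Real.pi * δ) *
          expNeg (ENNReal.ofReal (lam * Real.pi * δ) * ∑' t, (1 - expNeg (c k t)))) :=
  h.lintegral_cells (q := fun x => ⌊‖x‖ ^ 2 / δ⌋₊) (by fun_prop) (volume_annulus hlam hδ) a c

lemma floor_div_mul_le (hδ : 0 < δ) {r : ℝ} (hr : 0 ≤ r) : ⌊r / δ⌋₊ * δ ≤ r :=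
  (le_div_iff₀ hδ).1 (Nat.floor_le (div_nonneg hr hδ.le))

lemma le_floor_div_add_one_mul (hδ : 0 < δ) (r : ℝ) : r ≤ (⌊r / δ⌋₊ + 1) * δ :=
  (div_le_iff₀ hδ).1 (Nat.lt_floor_add_one _).le

lemma antitoneOn_expNeg_quadratic {a b : ℝ} (ha : 0 ≤ a) (hb : 0 ≤ b) :
    AntitoneOn (fun t => expNeg (ENNReal.ofReal (b * t ^ 2 + a * t))) (Set.Ici 0) := by
  intro t ht t' _ h
  have ht0 : 0 ≤ t := ht
  refine expNeg_antitone (ENNReal.ofReal_le_ofReal ?_)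
  gcongr

/-- The functional of the squared distances whose mean is the average number of discovered nodes,
up to a factor. -/
noncomputable def palmSum (p ξ b : ℝ) (x : ℕ → Plane) : ℝ≥0∞ :=
  ∑' i, expNeg (ENNReal.ofReal (b * (‖x i‖ ^ 2) ^ 2)) *
    expNeg (∑' j, if j = i then 0 else radialExponent p ξ (‖x i‖ ^ 2) (‖x j‖ ^ 2))

/-- Rounding the target inwards and the interferers outwards increases every term. The added `δ`
bounds the first cell of the outer Riemann sum, and the exponential factor accounts for the inner
one. -/
lemma lintegral_palmSum_le
    (h : IsPoissonProcess P (ENNReal.ofReal lam • (volume : Measure Plane)) X) (hlam : 0 ≤ lam)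
    (hp0 : 0 ≤ p) (hp1 : p < 1) (hξ : 0 < ξ) (hb : 0 ≤ b) (hδ : 0 < δ) :
    ∫⁻ ω, palmSum p ξ b (fun i => X i ω) ∂P
      ≤ ENNReal.ofReal (Real.exp (lam * Real.pi * δ * p)) * (ENNReal.ofReal (lam * Real.pi) *
        (ENNReal.ofReal δ + ∫⁻ t in Set.Ioi 0, expNeg (ENNReal.ofReal
          (b * t ^ 2 + lam * Real.pi * p * (Real.sqrt ξ * (Real.pi / 2)) * t)))) := by
  have hμ : 0 ≤ lam * Real.pi := by positivity
  set a := lam * Real.pi * p * (Real.sqrt ξ * (Real.pi / 2)) with ha_def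
  have ha : 0 ≤ a := by positivity
  set Q : ℝ → ℝ≥0∞ := fun t => expNeg (ENNReal.ofReal (b * t ^ 2 + a * t)) with hQ
  have hQa : AntitoneOn Q (Set.Ici 0) := antitoneOn_expNeg_quadratic ha hb
  calc ∫⁻ ω, palmSum p ξ b (fun i => X i ω) ∂P
      ≤ ∫⁻ ω, ∑' i, (fun k : ℕ => expNeg (ENNReal.ofReal (b * (k * δ) ^ 2))) ⌊‖X i ω‖ ^ 2 / δ⌋₊ *
          expNeg (∑' j, if j = i then 0 else
            (fun k l : ℕ => radialExponent p ξ (k * δ) ((l + 1) * δ))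
              ⌊‖X i ω‖ ^ 2 / δ⌋₊ ⌊‖X j ω‖ ^ 2 / δ⌋₊) ∂P := by
        refine lintegral_mono fun ω => ENNReal.tsum_le_tsum fun i => ?_
        have hi := floor_div_mul_le hδ (sq_nonneg ‖X i ω‖)
        refine mul_le_mul' (expNeg_antitone (ENNReal.ofReal_le_ofReal (by gcongr)))
          (expNeg_antitone (ENNReal.tsum_le_tsum fun j => ?_))
        split_ifs
        · exact le_rfl
        · exact radialExponent_le hp0 hp1 hξ (by positivity) hi (sq_nonneg _)
            (le_floor_div_add_one_mul hδ _)
    _ = ∑' k : ℕ, expNeg (ENNReal.ofReal (b * (k * δ) ^ 2)) *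
          (ENNReal.ofReal (lam * Real.pi * δ) * expNeg (ENNReal.ofReal (lam * Real.pi * δ) *
            ∑' l : ℕ, ENNReal.ofReal (p * interferenceRatio ξ (k * δ) ((l + 1) * δ)))) := by
        refine (h.lintegral_annuli hlam hδ
          (fun k : ℕ => expNeg (ENNReal.ofReal (b * (k * δ) ^ 2)))
          (fun k l : ℕ => radialExponent p ξ (k * δ) ((l + 1) * δ))).trans ?_
        simp_rw [one_sub_expNeg_radialExponent hp0 hp1 hξ.le]
    _ ≤ ∑' k : ℕ, ENNReal.ofReal (Real.exp (lam * Real.pi * δ * p)) *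
          (ENNReal.ofReal (lam * Real.pi) * (ENNReal.ofReal δ * Q (k * δ))) := by
        refine ENNReal.tsum_le_tsum fun k => ?_
        have hk : (0 : ℝ) ≤ k * δ := by positivity
        calc _ ≤ expNeg (ENNReal.ofReal (b * (k * δ) ^ 2)) *
              (ENNReal.ofReal (lam * Real.pi * δ) *
                (ENNReal.ofReal (Real.exp (lam * Real.pi * δ * p)) *
                  expNeg (ENNReal.ofReal (a * (k * δ))))) := by
              gcongr
              exact expNeg_upper_cells_le hp0 hξ hk hδ hμ
          _ = _ := by
              simp only [hQ]
              rw [ENNReal.ofReal_add (by positivity) (by positivity), expNeg_add,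
                ENNReal.ofReal_mul hμ]
              ring
    _ ≤ _ := by
        rw [ENNReal.tsum_mul_left, ENNReal.tsum_mul_left, tsum_cell_eq_add]
        gcongr
        · exact mul_le_of_le_one_right' (expNeg_le_one _)
        · exact tsum_le_setLIntegral_Ioi hδ hQa

/-- The opposite rounding, target outwards and interferers inwards, decreases every term. The errors
stand on the larger side, so nothing is subtracted in `[0, ∞]`. -/
lemma le_lintegral_palmSum
    (h : IsPoissonProcess P (ENNReal.ofReal lam • (volume : Measure Plane)) X) (hlam : 0 ≤ lam)
    (hp0 : 0 ≤ p) (hp1 : p < 1) (hξ : 0 < ξ) (hb : 0 ≤ b) (hδ : 0 < δ) :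
    ENNReal.ofReal (lam * Real.pi) * ∫⁻ t in Set.Ioi 0, expNeg (ENNReal.ofReal
          (b * t ^ 2 + lam * Real.pi * p * (Real.sqrt ξ * (Real.pi / 2)) * t))
      ≤ ENNReal.ofReal (lam * Real.pi) * ENNReal.ofReal δ +
        ENNReal.ofReal (Real.exp (lam * Real.pi * δ * p)) *
          ∫⁻ ω, palmSum p ξ b (fun i => X i ω) ∂P := by
  have hμ : 0 ≤ lam * Real.pi := by positivity
  set a := lam * Real.pi * p * (Real.sqrt ξ * (Real.pi / 2)) with ha_def
  have ha : 0 ≤ a := by positivity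
  set Q : ℝ → ℝ≥0∞ := fun t => expNeg (ENNReal.ofReal (b * t ^ 2 + a * t)) with hQ
  have hQa : AntitoneOn Q (Set.Ici 0) := antitoneOn_expNeg_quadratic ha hb
  have hlow : ∑' k : ℕ, ENNReal.ofReal (lam * Real.pi) * (ENNReal.ofReal δ * Q ((k + 1) * δ))
      ≤ ENNReal.ofReal (Real.exp (lam * Real.pi * δ * p)) *
          ∫⁻ ω, palmSum p ξ b (fun i => X i ω) ∂P := by
    calc _ ≤ ∑' k : ℕ, ENNReal.ofReal (Real.exp (lam * Real.pi * δ * p)) *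
          (expNeg (ENNReal.ofReal (b * ((k + 1) * δ) ^ 2)) *
          (ENNReal.ofReal (lam * Real.pi * δ) * expNeg (ENNReal.ofReal (lam * Real.pi * δ) *
            ∑' l : ℕ, ENNReal.ofReal (p * interferenceRatio ξ ((k + 1) * δ) (l * δ))))) := by
          refine ENNReal.tsum_le_tsum fun k => ?_
          have hk : (0 : ℝ) ≤ (k + 1) * δ := by positivity
          calc _ = expNeg (ENNReal.ofReal (b * ((k + 1) * δ) ^ 2)) *
                (ENNReal.ofReal (lam * Real.pi * δ) *
                  expNeg (ENNReal.ofReal (a * ((k + 1) * δ)))) := by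
                simp only [hQ]
                rw [ENNReal.ofReal_add (by positivity) (by positivity), expNeg_add,
                  ENNReal.ofReal_mul hμ]
                ring
            _ ≤ expNeg (ENNReal.ofReal (b * ((k + 1) * δ) ^ 2)) *
                (ENNReal.ofReal (lam * Real.pi * δ) *
                  (ENNReal.ofReal (Real.exp (lam * Real.pi * δ * p)) *
                    expNeg (ENNReal.ofReal (lam * Real.pi * δ) * ∑' l : ℕ,
                      ENNReal.ofReal (p * interferenceRatio ξ ((k + 1) * δ) (l * δ))))) := by
                gcongr
                exact le_expNeg_lower_cells hp0 hξ hk hδ hμ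
            _ = _ := by ring
      _ = ENNReal.ofReal (Real.exp (lam * Real.pi * δ * p)) * ∫⁻ ω, ∑' i,
          (fun k : ℕ => expNeg (ENNReal.ofReal (b * ((k + 1) * δ) ^ 2))) ⌊‖X i ω‖ ^ 2 / δ⌋₊ *
          expNeg (∑' j, if j = i then 0 else
            (fun k l : ℕ => radialExponent p ξ ((k + 1) * δ) (l * δ))
              ⌊‖X i ω‖ ^ 2 / δ⌋₊ ⌊‖X j ω‖ ^ 2 / δ⌋₊) ∂P := by
          rw [ENNReal.tsum_mul_left]
          refine congrArg _ (Eq.symm ((h.lintegral_annuli hlam hδ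
            (fun k : ℕ => expNeg (ENNReal.ofReal (b * ((k + 1) * δ) ^ 2)))
            (fun k l : ℕ => radialExponent p ξ ((k + 1) * δ) (l * δ))).trans ?_))
          simp_rw [one_sub_expNeg_radialExponent hp0 hp1 hξ.le]
      _ ≤ _ := by
          refine mul_le_mul_right (lintegral_mono fun ω => ENNReal.tsum_le_tsum fun i => ?_) _
          have hi := le_floor_div_add_one_mul hδ (‖X i ω‖ ^ 2)
          refine mul_le_mul' (expNeg_antitone (ENNReal.ofReal_le_ofReal (by gcongr)))
            (expNeg_antitone (ENNReal.tsum_le_tsum fun j => ?_))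
          split_ifs
          · exact le_rfl
          · exact radialExponent_le hp0 hp1 hξ (sq_nonneg _) hi (by positivity)
              (floor_div_mul_le hδ (sq_nonneg _))
  calc _ ≤ ENNReal.ofReal (lam * Real.pi) * ∑' k : ℕ, ENNReal.ofReal δ * Q (k * δ) := by
        gcongr
        exact setLIntegral_Ioi_le_tsum hδ hQa
    _ ≤ ENNReal.ofReal (lam * Real.pi) * (ENNReal.ofReal δ +
          ∑' k : ℕ, ENNReal.ofReal δ * Q ((k + 1) * δ)) := by
        rw [tsum_cell_eq_add]
        gcongr
        exact mul_le_of_le_one_right' (expNeg_le_one _)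
    _ ≤ _ := by
        rw [mul_add, ← ENNReal.tsum_mul_left]
        gcongr

lemma lintegral_palmSum
    (h : IsPoissonProcess P (ENNReal.ofReal lam • (volume : Measure Plane)) X) (hlam : 0 ≤ lam)
    (hp0 : 0 ≤ p) (hp1 : p < 1) (hξ : 0 < ξ) (hb : 0 ≤ b) :
    ∫⁻ ω, palmSum p ξ b (fun i => X i ω) ∂P
      = ENNReal.ofReal (lam * Real.pi) * ∫⁻ t in Set.Ioi 0, expNeg (ENNReal.ofReal
          (b * t ^ 2 + lam * Real.pi * p * (Real.sqrt ξ * (Real.pi / 2)) * t)) := by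
  set I := ∫⁻ t in Set.Ioi 0, expNeg (ENNReal.ofReal
          (b * t ^ 2 + lam * Real.pi * p * (Real.sqrt ξ * (Real.pi / 2)) * t))
  set Z := ∫⁻ ω, palmSum p ξ b (fun i => X i ω) ∂P
  have hδ : Filter.Tendsto ENNReal.ofReal (nhdsWithin 0 (Set.Ioi 0)) (nhds 0) := by
    have := ENNReal.continuous_ofReal.tendsto 0
    rw [ENNReal.ofReal_zero] at this
    exact this.mono_left nhdsWithin_le_nhds
  have hexp : Filter.Tendsto (fun δ => ENNReal.ofReal (Real.exp (lam * Real.pi * δ * p)))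
      (nhdsWithin 0 (Set.Ioi 0)) (nhds 1) := by
    have : Continuous fun δ => ENNReal.ofReal (Real.exp (lam * Real.pi * δ * p)) :=
      ENNReal.continuous_ofReal.comp (by fun_prop)
    have := this.tendsto 0
    simp only [mul_zero, zero_mul, Real.exp_zero, ENNReal.ofReal_one] at this
    exact this.mono_left nhdsWithin_le_nhds
  refine le_antisymm ?_ ?_
  · have hlim : Filter.Tendsto (fun δ => ENNReal.ofReal (Real.exp (lam * Real.pi * δ * p)) *
        (ENNReal.ofReal (lam * Real.pi) * (ENNReal.ofReal δ + I)))
        (nhdsWithin 0 (Set.Ioi 0)) (nhds (1 * (ENNReal.ofReal (lam * Real.pi) * (0 + I)))) :=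
      -- The limit `1` is neither `0` nor `∞`, so the product converges even if `I` is infinite.
      ENNReal.Tendsto.mul hexp (Or.inl one_ne_zero)
        (ENNReal.Tendsto.const_mul (hδ.add tendsto_const_nhds) (Or.inr ENNReal.ofReal_ne_top))
        (Or.inr ENNReal.one_ne_top)
    rw [one_mul, zero_add] at hlim
    refine ge_of_tendsto hlim ?_
    filter_upwards [self_mem_nhdsWithin] with δ hδ
    exact lintegral_palmSum_le h hlam hp0 hp1 hξ hb hδ
  · have hlim : Filter.Tendsto (fun δ => ENNReal.ofReal (lam * Real.pi) * ENNReal.ofReal δ +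
        ENNReal.ofReal (Real.exp (lam * Real.pi * δ * p)) * Z)
        (nhdsWithin 0 (Set.Ioi 0)) (nhds (ENNReal.ofReal (lam * Real.pi) * 0 + 1 * Z)) :=
      (ENNReal.Tendsto.const_mul hδ (Or.inr ENNReal.ofReal_ne_top)).add
        (ENNReal.Tendsto.mul_const hexp (Or.inl one_ne_zero))
    rw [one_mul, mul_zero, zero_add] at hlim
    refine ge_of_tendsto hlim ?_
    filter_upwards [self_mem_nhdsWithin] with δ hδ
    exact le_lintegral_palmSum h hlam hp0 hp1 hξ hb hδ

end Planar

/-! ### The mean as a one-dimensional integral, and the bounds -/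

namespace HelloSlot

variable {Ω : Type*} [MeasurableSpace Ω] {P : Measure Ω} [IsProbabilityMeasure P]
  {lam : ℝ} {M : ℕ} {ρ noise ξ : ℝ}

/-- The average number of discovered nodes as a one-dimensional integral, for the path loss
exponent four. -/
lemma meanDiscovered_four_eq (s : HelloSlot P lam M ρ rayleighGain) (hlam : 0 < lam)
    (hM : 0 < M) (hρ0 : 0 < ρ) (hρ1 : ρ < 1) (hξ : 0 < ξ) (hn : 0 ≤ noise) :
    s.meanDiscovered 4 noise ξ = ENNReal.ofReal ((1 - ρ) * ρ * (lam * Real.pi) *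
      ∫ t in Set.Ioi 0, Real.exp (-(ξ * noise * t ^ 2 +
        lam * Real.pi * (ρ / M) * (Real.sqrt ξ * (Real.pi / 2)) * t))) := by
  have hM1 : (1 : ℝ) ≤ M := by exact_mod_cast hM
  have hp0 : 0 < ρ / M := by positivity
  have hp1 : ρ / M < 1 := (div_le_self hρ0.le hM1).trans_lt hρ1
  have hne : ∀ᵐ ω ∂P, ∀ j, s.X j ω ≠ 0 :=
    s.poisson.ae_notMem (measurableSet_singleton 0) (by simp)
  have hpalm : ∫⁻ ω, ∑' i, expNeg (ENNReal.ofReal (ξ * noise / ‖s.X i ω‖ ^ (-4 : ℝ))) *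
        expNeg (∑' j, if j = i then 0 else interferenceExponent (ρ / M)
          (ξ / ‖s.X i ω‖ ^ (-4 : ℝ) * ‖s.X j ω‖ ^ (-4 : ℝ))) ∂P
      = ∫⁻ ω, palmSum (ρ / M) ξ (ξ * noise) (fun i => s.X i ω) ∂P := by
    refine lintegral_congr_ae ?_
    filter_upwards [hne] with ω hω
    have hpow : ∀ j, ‖s.X j ω‖ ^ (-4 : ℝ) = ((‖s.X j ω‖ ^ 2) ^ 2)⁻¹ := fun j => by
      rw [Real.rpow_neg (norm_nonneg _), ← pow_mul]
      norm_cast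
    have hpos : ∀ j, 0 < ‖s.X j ω‖ ^ 2 := fun j => by
      have := norm_pos_iff.2 (hω j)
      positivity
    refine tsum_congr fun i => ?_
    rw [hpow i, div_inv_eq_mul]
    congr 2
    refine tsum_congr fun j => ?_
    split_ifs
    · rfl
    · have hi := hpos i
      have hj := hpos j
      rw [hpow j, interferenceExponent, radialExponent, interferenceRatio]
      generalize ‖s.X i ω‖ ^ 2 = u at hi
      generalize ‖s.X j ω‖ ^ 2 = v at hj
      have hθ : 0 < ξ * u ^ 2 / v ^ 2 := by positivity
      -- With `u`, `v` the squared distances, `θ = ξ u² / v²`, so `θ / (1 + θ)` is the interference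
      -- ratio.
      congr 5
      rw [div_inv_eq_mul, ← div_eq_mul_inv, div_eq_div_iff (by positivity) (by positivity)]
      field_simp
  rw [s.meanDiscovered_eq hM hρ0.le hρ1 hξ, hpalm,
    lintegral_palmSum s.poisson hlam.le hp0.le hp1 hξ (by positivity),
    setLIntegral_expNeg_quadratic (by positivity) (by positivity),
    ← ENNReal.ofReal_mul (by positivity), ← ENNReal.ofReal_mul (by nlinarith),
    ← mul_assoc ((1 - ρ) * ρ)]

end HelloSlot

section Bounds

variable {lam M ρ ξ noise : ℝ}

lemma upperBound_eq (hlam : 0 < lam) (hM : 0 < M) (hρ0 : 0 < ρ) (hξ : 0 < ξ) :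
    upperBound M ρ ξ = (1 - ρ) * ρ * (lam * Real.pi) *
      (1 / (lam * Real.pi * (ρ / M) * (Real.sqrt ξ * (Real.pi / 2)))) := by
  have := Real.sqrt_pos.2 hξ
  rw [upperBound]
  field_simp

/-- With `a` the linear rate and `b = ξ * noise`, one has `κ ρ² = a² / (2 b)`, so the correction
factor is `a² / (a² + 2 b)`, applied to the zero-noise value `1 / a`. -/
lemma lowerBound_eq (hlam : 0 < lam) (hM : 0 < M) (hρ0 : 0 < ρ) (hξ : 0 < ξ) (hn : 0 < noise) :
    lowerBound lam M ρ ξ noise = (1 - ρ) * ρ * (lam * Real.pi) *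
      (lam * Real.pi * (ρ / M) * (Real.sqrt ξ * (Real.pi / 2)) /
        ((lam * Real.pi * (ρ / M) * (Real.sqrt ξ * (Real.pi / 2))) ^ 2 + 2 * (ξ * noise))) := by
  obtain ⟨r, hr, rfl⟩ : ∃ r, 0 < r ∧ ξ = r ^ 2 :=
    ⟨Real.sqrt ξ, Real.sqrt_pos.2 hξ, (Real.sq_sqrt hξ.le).symm⟩
  rw [lowerBound, kappa, Real.sqrt_sq hr.le]
  field_simp
  ring

lemma bounds_of_eq_integral (hlam : 0 < lam) (hM : 0 < M) (hρ0 : 0 < ρ) (hρ1 : ρ < 1)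
    (hξ : 0 < ξ) {E : ℝ → ℝ≥0∞} (hE : ∀ noise, 0 ≤ noise → E noise =
      ENNReal.ofReal ((1 - ρ) * ρ * (lam * Real.pi) *
        ∫ t in Set.Ioi 0, Real.exp (-(ξ * noise * t ^ 2 +
          lam * Real.pi * (ρ / M) * (Real.sqrt ξ * (Real.pi / 2)) * t)))) :
    (∀ noise : ℝ, 0 < noise → ENNReal.ofReal (lowerBound lam M ρ ξ noise) < E noise ∧
      E noise < ENNReal.ofReal (upperBound M ρ ξ)) ∧
      E 0 = ENNReal.ofReal (upperBound M ρ ξ) := by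
  have ha : 0 < lam * Real.pi * (ρ / M) * (Real.sqrt ξ * (Real.pi / 2)) := by
    have := Real.sqrt_pos.2 hξ
    positivity
  have hC : 0 < (1 - ρ) * ρ * (lam * Real.pi) := by
    have : 0 < 1 - ρ := by linarith
    positivity
  rw [upperBound_eq hlam hM hρ0 hξ]
  refine ⟨fun noise hn => ?_, ?_⟩
  · have hb : 0 < ξ * noise := by positivity
    have hlo := lt_integral_exp_quadratic ha hb
    have hup := integral_exp_quadratic_lt ha hb
    -- Strict inequality survives `ENNReal.ofReal` only if the larger side is positive.
    have hpos := (div_pos ha (by positivity)).trans hlo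
    rw [hE noise hn.le, lowerBound_eq hlam hM hρ0 hξ hn]
    exact ⟨(ENNReal.ofReal_lt_ofReal_iff (mul_pos hC hpos)).2 (mul_lt_mul_of_pos_left hlo hC),
      (ENNReal.ofReal_lt_ofReal_iff (mul_pos hC (hpos.trans hup))).2
        (mul_lt_mul_of_pos_left hup hC)⟩
  · rw [hE 0 le_rfl]
    simp_rw [mul_zero, zero_mul, zero_add]
    rw [integral_exp_neg_mul_Ioi ha]

end Bounds

/-- Bounds on the average number of discovered nodes under Rayleigh fading with path loss exponent
four, and its value without noise. First for a slot with `M` resource blocks; then for a positive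
real `M`, where the average is `M` times that of a single resource block, on which the nodes have
density `lam / M`. -/
theorem mainTheorem8 {Ω : Type*} [MeasurableSpace Ω] (P : Measure Ω) [IsProbabilityMeasure P]
    (lam ρ ξ : ℝ) (hlam : 0 < lam) (hρ0 : 0 < ρ) (hρ1 : ρ < 1) (hξ : 0 < ξ) :
    (∀ M : ℕ, 0 < M → ∀ s : HelloSlot P lam M ρ rayleighGain,
      (∀ noise : ℝ, 0 < noise →
        ENNReal.ofReal (lowerBound lam M ρ ξ noise) < s.meanDiscovered 4 noise ξ ∧
        s.meanDiscovered 4 noise ξ < ENNReal.ofReal (upperBound M ρ ξ)) ∧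
      s.meanDiscovered 4 0 ξ = ENNReal.ofReal (upperBound M ρ ξ)) ∧
    (∀ M : ℝ, 0 < M → ∀ s : HelloSlot P (lam / M) 1 ρ rayleighGain,
      (∀ noise : ℝ, 0 < noise →
        ENNReal.ofReal (lowerBound lam M ρ ξ noise) <
          ENNReal.ofReal M * s.meanDiscovered 4 noise ξ ∧
        ENNReal.ofReal M * s.meanDiscovered 4 noise ξ < ENNReal.ofReal (upperBound M ρ ξ)) ∧
      ENNReal.ofReal M * s.meanDiscovered 4 0 ξ = ENNReal.ofReal (upperBound M ρ ξ)) := by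
  refine ⟨fun M hM s => ?_, fun M hM s => ?_⟩
  · exact bounds_of_eq_integral hlam (Nat.cast_pos.2 hM) hρ0 hρ1 hξ
      fun noise hn => s.meanDiscovered_four_eq hlam hM hρ0 hρ1 hξ hn
  · refine bounds_of_eq_integral hlam hM hρ0 hρ1 hξ
      (E := fun noise => ENNReal.ofReal M * s.meanDiscovered 4 noise ξ) fun noise hn => ?_
    -- The linear rate depends on density and block probability only through their product, so
    -- density `lam / M` on one block matches density `lam` on `M` blocks; the factor `M` then
    -- restores the prefactor.
    have hrate : lam / M * Real.pi * (ρ / (1 : ℕ)) * (Real.sqrt ξ * (Real.pi / 2))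
        = lam * Real.pi * (ρ / M) * (Real.sqrt ξ * (Real.pi / 2)) := by
      push_cast
      field_simp
    rw [s.meanDiscovered_four_eq (div_pos hlam hM) one_pos hρ0 hρ1 hξ hn, hrate,
      ← ENNReal.ofReal_mul hM.le, ← mul_assoc]
    congr 2
    field_simp
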